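/- **Setting.** Along a sequence of samples (index $r\to\infty$, suppressed below; all data and parameters may depend on $r$) there are $n$ individuals and $T=2^{L-1}+1$ periods, $L\ge 2$, and $$Y_{it}=\mu+X_{it}'\beta_t+\alpha_i+\theta_t+e_{it},\qquad i=1,\dots,n,\ t=1,\dots,T,$$ with $X_{it}\in\mathbb R^P$, $P$ fixed, $\alpha_i,\theta_t$ arbitrary (possibly random), and $\beta_{t,p}=\sum_{j=1}^{S_p+1}\mathbf 1(\tau_{j-1,p}<t\le\tau_{j,p})\,\beta_{\tau_{j,p},p}$, where $0=\tau_{0,p}<\tau_{1,p}<\dots<\tau_{S_p,p}<\tau_{S_p+1,p}=T$ (all of these, including $S_p$, may vary with the sample). Put $\Delta v_t=v_t-v_{t-1}$, $\underline P=2P+1$, $\underline X_{it}=(X_{it}',-X_{i,t-1}',1)'$, and let $\underline Z_{it}\in\mathbb R^{\underline P}$ ($t=2,\dots,T$) be instruments. **Estimators.** Let $I_{l,m}(t)=1$ if $2^{L-l}(m-1)+1\le t\le 2^{L-l}m$ and $0$ otherwise, $H_{l,m}(t)=\sqrt{2^{l-2}}\,I_{l,m}(t-1)$, $\psi_{l,k}=\sqrt{2^{l-2}}(I_{l,2k-1}-I_{l,2k})$,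 $K_1=1$, $K_l=2^{l-2}$ for $l\ge2$. Let $\underline Q_{1,1}=\frac1{n(T-1)}\sum_{i,t}\underline Z_{it}\underline X_{it}'$ and $\underline Q_{l,m}=\frac1{n(T-1)}\sum_{i,t}\underline Z_{it}\underline X_{it}'H_{l,m}(t)^2$ for $l\ge2$ (sums over $1\le i\le n$, $2\le t\le T$), $A_{1,1}=\underline Q_{1,1}^{-1/2}$ and, for $m\in\{2k-1,2k\}$, $A_{l,m}=\underline Q_{l,m}^{-1}(\underline Q_{l,2k-1}^{-1}+\underline Q_{l,2k}^{-1})^{-1/2}$. Here $M^{-1/2}$ is any real matrix whose square is $M^{-1}$; it is supposed that such matrices exist almost surely in all late samples. Put $W_{1,1}(t)=A_{1,1}$, $W_{l,k}(t)=A_{l,2k-1}H_{l,2k-1}(t)-A_{l,2k}H_{l,2k}(t)$, $\underline{\mathcal Z}_{l,k,it}=W_{l,k}(t)'\underline Z_{it}$, $\underline{\mathcal X}_{l,k,it}=W_{l,k}(t)'\underline X_{it}$. The IV estimators $\underline{\tilde b}_{l,k}$ solve the moment conditions $$\frac1{n(T-1)}\sum_{i=1}^n\sum_{t=2}^T\underline{\mathcal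 Z}_{l,k,it}\Big(\Delta Y_{it}-\sum_{l',k'}\underline{\mathcal X}_{l',k',it}'\,\underline{\tilde b}_{l',k'}\Big)=0\quad\text{for all }1\le l\le L,\ 1\le k\le K_l$$ (when $\frac1{n(T-1)}\sum_{i,t}\underline{\mathcal Z}_{l,k,it}\underline{\mathcal X}_{l',k',it}'$ is the identity for $(l,k)=(l',k')$ and $0$ otherwise, this is $\underline{\tilde b}_{l,k}=\frac1{n(T-1)}\sum_{i,t}\underline{\mathcal Z}_{l,k,it}\Delta Y_{it}$). Let $\tilde\gamma_t=\sum_{l,k}W_{l,k}(t)\underline{\tilde b}_{l,k}$ and, for $p\le P$, $$\tilde c^{(s)}_{l,k,p}=\tfrac1{T-1}\sum_{t=2}^T\psi_{l,k}(t-1)\tilde\gamma_{t,p},\qquad \tilde c^{(u)}_{l,k,p}=\tfrac1{T-1}\sum_{t=1}^{T-1}\psi_{l,k}(t)\tilde\gamma_{t+1,p+P},$$ $\hat c^{(\cdot)}=\tilde c^{(\cdot)}\mathbf 1(|\tilde c^{(\cdot)}|>\lambda_{nT})$ for a deterministic threshold $\lambda_{nT}$, $\mathcal E=\{2,4,\dots,T-1\}$,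 $\mathcal E^c=\{2,\dots,T\}\setminus\mathcal E$, $$\Delta\tilde\beta^{(u)}_{t,p}=\sum_{k=1}^{K_L}\Delta\psi_{L,k}(t)\,\hat c^{(u)}_{L,k,p}\ (t\in\mathcal E),\qquad \Delta\tilde\beta^{(s)}_{t,p}=\sum_{k=1}^{K_L}\Delta\psi_{L,k}(t-1)\,\hat c^{(s)}_{L,k,p}\ (t\in\mathcal E^c).$$ Let $N_p(s)$ be the number of $t\le s$ with either $t\in\mathcal E$ and $\Delta\tilde\beta^{(u)}_{t,p}\ne0$, or $t\in\mathcal E^c$ and $\Delta\tilde\beta^{(s)}_{t,p}\neq0$. Put $\tilde S_p=N_p(T)$ and $\tilde\tau_{j,p}=\min\{s: N_p(s+1)=j\}$ for $1\le j\le\tilde S_p$. **Assumptions.** (A) $n\to\infty$, and either $T$ is fixed, or $T\to\infty$ with $\log(T)^\varepsilon/n\to0$ for all $\varepsilon>0$. (B) $E(\underline Z_{it}\Delta e_{it})=0$ for all $i,t$. There is $c>0$ such that for all late samples, almost surely, $\|\bar Q_{l,m}v\|\ge c\|v\|$ for all $v\in\mathbb R^{\underline P}$, $1\le l\le L$, $1\le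 m\le 2^{l-1}$, where $\bar Q_{l,m}$ is the average of $\underline Z_{it}\underline X_{it}'$ over $i\le n$ and over those $t$ with $H_{l,m}(t)\ne0$ (for symmetric positive definite $\bar Q_{l,m}$: its smallest eigenvalue is at least $c$). $E\|\underline Z_{it}\|^4$ and $E\|\underline X_{it}\|^4$ are bounded uniformly. (C) With $\sigma^2_{n,s,s';q}=\frac1{n(s'-s+1)}E\big[\big(\sum_{i=1}^n\sum_{t=s+1}^{s'}\underline Z_{it,q}\Delta e_{it}\big)^2\big]$ there are $M<\infty$ and $\delta_0,\delta_1,\delta_2\in(0,\infty)$, the same for all samples, such that for all $1\le s<s'\le T$, $1\le q\le\underline P$, $a>0$: $\sigma^2_{n,s,s';q}\le M$ and $$P\Big(\tfrac1{\sqrt{n(s'-s+1)}}\Big|\sum_{i=1}^n\sum_{t=s+1}^{s'}\underline Z_{it,q}\Delta e_{it}\Big|\ge a\,\sigma_{n,s,s';q}\Big)\le\delta_0\exp(-\delta_1a^{\delta_2}).$$ (D) For some $\kappa^*\ge0$ and $c>0$, in all late samples $\big(n/\log(T-1)^{2/\delta_2}\big)^{\kappa^*/2}\,|\beta_{\tau_{j+1,p},p}-\beta_{\tau_{j,p},p}|>c$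 for all $p\le P$, $1\le j\le S_p$. **Theorem 2.** Assume A–D, and that $\frac{\sqrt{n(T-1)}}{\log(T-1)^{1/\delta_2}}\lambda_{nT}\to\infty$, $\sqrt{T-1}\,\lambda_{nT}\to0$ and, with the $\kappa^*$ of (D), $\big(n/\log(T-1)^{2/\delta_2}\big)^{\kappa^*/2}\sqrt{T-1}\,\lambda_{nT}\to0$. Then (i) $P(\tilde S_1=S_1,\dots,\tilde S_P=S_P)\to1$, and (ii) $P\big(\tilde\tau_{j,p}=\tau_{j,p}\text{ for all }p\le P,\ 1\le j\le S_p\ \big|\ \tilde S_1=S_1,\dots,\tilde S_P=S_P\big)\to1$. -/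

import Mathlib

open MeasureTheory ProbabilityTheory Filter Topology
open scoped Matrix

noncomputable section

namespace SAW

/-! ## The Haar system on `T - 1 = 2 ^ (L - 1)` points -/

/-- The number of time periods, `T = 2 ^ (L - 1) + 1`. -/
def periods (L : ℕ) : ℕ := 2 ^ (L - 1) + 1

/-- Indicator `I_{l,m}(t)` of the dyadic block `2^(L-l) (m-1) + 1 ≤ t ≤ 2^(L-l) m`. -/
def haarInd (L l m t : ℕ) : ℝ :=
  if 2 ^ (L - l) * (m - 1) + 1 ≤ t ∧ t ≤ 2 ^ (L - l) * m then 1 else 0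

/-- `ψ_{l,k}(t) = √(2^(l-2)) (I_{l,2k-1}(t) - I_{l,2k}(t))`, used for `l ≥ 2`. -/
def haarPsi (L l k t : ℕ) : ℝ :=
  √((2 : ℝ) ^ (l - 2)) * (haarInd L l (2 * k - 1) t - haarInd L l (2 * k) t)

/-- `H_{l,m}(t) = √(2^(l-2)) I_{l,m}(t-1)`; only its support is used when `l = 1`. -/
def haarH (L l m t : ℕ) : ℝ := √((2 : ℝ) ^ (l - 2)) * haarInd L l m (t - 1)

/-- The number of basis functions at level `l`: one for `l = 1`, and `2^(l-2)` for `l ≥ 2`. -/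
def numK (l : ℕ) : ℕ := if l = 1 then 1 else 2 ^ (l - 2)

/-! ## The estimators, computed from one sample

A sample consists of `X i t`, `Z i t` and `dY i t = ΔY_{it}`, where `i = 1, …, n` and `t ≤ T`. -/

/-- Index set of the `2P + 1` coordinates of `(β_t, β_{t-1}, Δθ_t)`: the first summand is
`p = 1, …, P`, the second one `P + p`, the last one the unit regressor. -/
abbrev UIdx (P : ℕ) : Type := Fin P ⊕ Fin P ⊕ Unit

section sample

variable {P : ℕ}

/-- The regressor `(X_{it}', -X_{i,t-1}', 1)'` of the differenced model. -/
def regU (X : ℕ → ℕ → Fin P → ℝ) (i t : ℕ) : UIdx P → ℝ :=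
  Sum.elim (X i t) (Sum.elim (fun p => -X i (t - 1) p) (fun _ => 1))

/-- The matrices `Q_{1,1} = (n(T-1))⁻¹ ∑ᵢ ∑ₜ Z X'` and
`Q_{l,m} = (n(T-1))⁻¹ ∑ᵢ ∑ₜ Z X' H_{l,m}(t)²` (`l ≥ 2`) that define the basis. -/
def Qmat (n L : ℕ) (X : ℕ → ℕ → Fin P → ℝ) (Z : ℕ → ℕ → UIdx P → ℝ) (l m : ℕ) :
    Matrix (UIdx P) (UIdx P) ℝ :=
  ((n : ℝ) * ((periods L : ℝ) - 1))⁻¹ •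
    ∑ i ∈ Finset.Icc 1 n, ∑ t ∈ Finset.Icc 2 (periods L),
      (if l = 1 then (1 : ℝ) else haarH L l m t ^ 2) • Matrix.vecMulVec (Z i t) (regU X i t)

/-- The plain average of `Z X'` over the individuals and over the block `{s | H_{l,m}(s) ≠ 0}`. -/
def Qavg (n L : ℕ) (X : ℕ → ℕ → Fin P → ℝ) (Z : ℕ → ℕ → UIdx P → ℝ) (l m : ℕ) :
    Matrix (UIdx P) (UIdx P) ℝ :=
  ((n : ℝ) * (((Finset.Icc 2 (periods L)).filter (fun s => haarH L l m s ≠ 0)).card : ℝ))⁻¹ •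
    ∑ t ∈ (Finset.Icc 2 (periods L)).filter (fun s => haarH L l m s ≠ 0),
      ∑ i ∈ Finset.Icc 1 n, Matrix.vecMulVec (Z i t) (regU X i t)

/-- `R` is an inverse square root `M^(-1/2)` of `M`. -/
def IsInvSqrt (M R : Matrix (UIdx P) (UIdx P) ℝ) : Prop := R * R * M = 1

/-- The structure-adapted choice of the matrices `A_{l,k}`:
`A_{1,1} = Q_{1,1}^(-1/2)`, and for `l ≥ 2`, with `R = (Q_{l,2k-1}⁻¹ + Q_{l,2k}⁻¹)^(-1/2)`,
`A_{l,2k-1} = Q_{l,2k-1}⁻¹ R` and `A_{l,2k} = Q_{l,2k}⁻¹ R`. -/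
structure IsSAWBasis (n L : ℕ) (X : ℕ → ℕ → Fin P → ℝ) (Z : ℕ → ℕ → UIdx P → ℝ)
    (A : ℕ → ℕ → Matrix (UIdx P) (UIdx P) ℝ) : Prop where
  level_one : IsInvSqrt (Qmat n L X Z 1 1) (A 1 1)
  level : ∀ l ∈ Finset.Icc 2 L, ∀ k ∈ Finset.Icc 1 (numK l),
    ∃ R, IsInvSqrt ((Qmat n L X Z l (2 * k - 1))⁻¹ + (Qmat n L X Z l (2 * k))⁻¹) R ∧
      A l (2 * k - 1) = (Qmat n L X Z l (2 * k - 1))⁻¹ * R ∧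
      A l (2 * k) = (Qmat n L X Z l (2 * k))⁻¹ * R

/-- The multivariate basis functions `W_{l,k}(t)`. -/
def basisW (L : ℕ) (A : ℕ → ℕ → Matrix (UIdx P) (UIdx P) ℝ) (l k t : ℕ) :
    Matrix (UIdx P) (UIdx P) ℝ :=
  if l = 1 then A 1 1
  else haarH L l (2 * k - 1) t • A l (2 * k - 1) - haarH L l (2 * k) t • A l (2 * k)

/-- The modified instrument, `𝒵_{l,k,it}' = Z_{it}' W_{l,k}(t)`. -/
def modZ (L : ℕ) (A : ℕ → ℕ → Matrix (UIdx P) (UIdx P) ℝ) (Z : ℕ → ℕ → UIdx P → ℝ)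
    (l k i t : ℕ) : UIdx P → ℝ := Z i t ᵥ* basisW L A l k t

/-- The modified regressor, `𝒳_{l,k,it}' = (X_{it}', -X_{i,t-1}', 1) W_{l,k}(t)`. -/
def modX (L : ℕ) (A : ℕ → ℕ → Matrix (UIdx P) (UIdx P) ℝ) (X : ℕ → ℕ → Fin P → ℝ)
    (l k i t : ℕ) : UIdx P → ℝ := regU X i t ᵥ* basisW L A l k t

/-- `b` is the IV estimator of the basis coefficients in `ΔY = ∑_{l,k} 𝒳_{l,k}' b_{l,k} + Δe`:
it solves the empirical moment condition for every modified instrument. -/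
def IsIVEstimator (n L : ℕ) (X : ℕ → ℕ → Fin P → ℝ) (Z : ℕ → ℕ → UIdx P → ℝ)
    (A : ℕ → ℕ → Matrix (UIdx P) (UIdx P) ℝ) (dY : ℕ → ℕ → ℝ)
    (b : ℕ → ℕ → UIdx P → ℝ) : Prop :=
  ∀ l ∈ Finset.Icc 1 L, ∀ k ∈ Finset.Icc 1 (numK l),
    ((n : ℝ) * ((periods L : ℝ) - 1))⁻¹ •
      ∑ i ∈ Finset.Icc 1 n, ∑ t ∈ Finset.Icc 2 (periods L),
        (dY i t - ∑ l' ∈ Finset.Icc 1 L, ∑ k' ∈ Finset.Icc 1 (numK l'),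
          modX L A X l' k' i t ⬝ᵥ b l' k') • modZ L A Z l k i t = 0

/-- The empirical cross moments `(n(T-1))⁻¹ ∑ᵢ ∑ₜ 𝒵_{l,k,it} 𝒳_{l',k',it}'`. -/
def crossMoment (n L : ℕ) (X : ℕ → ℕ → Fin P → ℝ) (Z : ℕ → ℕ → UIdx P → ℝ)
    (A : ℕ → ℕ → Matrix (UIdx P) (UIdx P) ℝ) (l k l' k' : ℕ) : Matrix (UIdx P) (UIdx P) ℝ :=
  ((n : ℝ) * ((periods L : ℝ) - 1))⁻¹ •
    ∑ i ∈ Finset.Icc 1 n, ∑ t ∈ Finset.Icc 2 (periods L),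
      Matrix.vecMulVec (modZ L A Z l k i t) (modX L A X l' k' i t)

/-- Whenever the basis is orthonormal for the empirical cross moments, the IV estimator is
`b_{l,k} = (n(T-1))⁻¹ ∑ᵢ ∑ₜ 𝒵_{l,k,it} ΔY_{it}`. -/
theorem isIVEstimator_iff_of_orthonormal (n L : ℕ) (X : ℕ → ℕ → Fin P → ℝ)
    (Z : ℕ → ℕ → UIdx P → ℝ) (A : ℕ → ℕ → Matrix (UIdx P) (UIdx P) ℝ) (dY : ℕ → ℕ → ℝ)
    (b : ℕ → ℕ → UIdx P → ℝ)
    (horth : ∀ l ∈ Finset.Icc 1 L, ∀ k ∈ Finset.Icc 1 (numK l),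
      ∀ l' ∈ Finset.Icc 1 L, ∀ k' ∈ Finset.Icc 1 (numK l'),
        crossMoment n L X Z A l k l' k' = if l' = l ∧ k' = k then 1 else 0) :
    IsIVEstimator n L X Z A dY b ↔
      ∀ l ∈ Finset.Icc 1 L, ∀ k ∈ Finset.Icc 1 (numK l),
        b l k = ((n : ℝ) * ((periods L : ℝ) - 1))⁻¹ •
          ∑ i ∈ Finset.Icc 1 n, ∑ t ∈ Finset.Icc 2 (periods L), dY i t • modZ L A Z l k i t := by
  have key : ∀ l ∈ Finset.Icc 1 L, ∀ k ∈ Finset.Icc 1 (numK l),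
      ((n : ℝ) * ((periods L : ℝ) - 1))⁻¹ •
        ∑ i ∈ Finset.Icc 1 n, ∑ t ∈ Finset.Icc 2 (periods L),
          (∑ l' ∈ Finset.Icc 1 L, ∑ k' ∈ Finset.Icc 1 (numK l'),
            modX L A X l' k' i t ⬝ᵥ b l' k') • modZ L A Z l k i t = b l k := by
    intro l hl k hk
    have h1 : ∀ l' k', crossMoment n L X Z A l k l' k' *ᵥ b l' k' =
        ((n : ℝ) * ((periods L : ℝ) - 1))⁻¹ •
          ∑ i ∈ Finset.Icc 1 n, ∑ t ∈ Finset.Icc 2 (periods L),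
            (modX L A X l' k' i t ⬝ᵥ b l' k') • modZ L A Z l k i t := by
      intro l' k'
      simp only [crossMoment, Matrix.smul_mulVec, Matrix.sum_mulVec, Matrix.vecMulVec_mulVec, op_smul_eq_smul]
    have h2 : ∑ l' ∈ Finset.Icc 1 L, ∑ k' ∈ Finset.Icc 1 (numK l'),
        crossMoment n L X Z A l k l' k' *ᵥ b l' k' = b l k := by
      rw [Finset.sum_eq_single_of_mem l hl, Finset.sum_eq_single_of_mem k hk]
      · rw [horth l hl k hk l hl k hk]; simp
      · intro k' hk' hne
        rw [horth l hl k hk l hl k' hk']; simp [hne]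
      · intro l' hl' hne
        refine Finset.sum_eq_zero fun k' hk' => ?_
        rw [horth l hl k hk l' hl' k' hk']; simp [hne]
    rw [← h2]
    simp only [h1, ← Finset.smul_sum, Finset.sum_smul]
    congr 1
    have swap : ∀ (s : Finset ℕ) (f : ℕ → ℕ → ℕ → UIdx P → ℝ),
        ∑ i ∈ s, ∑ l' ∈ Finset.Icc 1 L, ∑ k' ∈ Finset.Icc 1 (numK l'), f i l' k' =
          ∑ l' ∈ Finset.Icc 1 L, ∑ k' ∈ Finset.Icc 1 (numK l'), ∑ i ∈ s, f i l' k' := by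
      intro s f
      rw [Finset.sum_comm]
      exact Finset.sum_congr rfl fun l' _ => Finset.sum_comm
    simp only [swap]
  unfold IsIVEstimator
  refine forall₂_congr fun l hl => forall₂_congr fun k hk => ?_
  simp only [sub_smul, Finset.sum_sub_distrib, smul_sub, key l hl k hk]
  rw [sub_eq_zero, eq_comm]

/-- `γ̃_t = ∑_{l,k} W_{l,k}(t) b̃_{l,k}`. -/
def gammaTilde (L : ℕ) (A : ℕ → ℕ → Matrix (UIdx P) (UIdx P) ℝ) (b : ℕ → ℕ → UIdx P → ℝ)
    (t : ℕ) : UIdx P → ℝ :=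
  ∑ l ∈ Finset.Icc 1 L, ∑ k ∈ Finset.Icc 1 (numK l), basisW L A l k t *ᵥ b l k

/-- The shifted univariate coefficients
`c̃^(s)_{l,k,p} = (T-1)⁻¹ ∑_{t=2}^T ψ_{l,k}(t-1) γ̃_{t,p}`. -/
def coefS (L : ℕ) (γ : ℕ → UIdx P → ℝ) (l k : ℕ) (p : Fin P) : ℝ :=
  ((periods L : ℝ) - 1)⁻¹ *
    ∑ t ∈ Finset.Icc 2 (periods L), haarPsi L l k (t - 1) * γ t (Sum.inl p)

/-- The unshifted univariate coefficients
`c̃^(u)_{l,k,p} = (T-1)⁻¹ ∑_{t=1}^{T-1} ψ_{l,k}(t) γ̃_{t+1,p+P}`. -/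
def coefU (L : ℕ) (γ : ℕ → UIdx P → ℝ) (l k : ℕ) (p : Fin P) : ℝ :=
  ((periods L : ℝ) - 1)⁻¹ *
    ∑ t ∈ Finset.Icc 1 (periods L - 1), haarPsi L l k t * γ (t + 1) (Sum.inr (Sum.inl p))

/-- Hard thresholding, `c 𝟏(|c| > lam)`. -/
def hardThreshold (lam c : ℝ) : ℝ := if lam < |c| then c else 0

/-- `Δβ̃^(u)_{t,p} = ∑_k (ψ_{L,k}(t) - ψ_{L,k}(t-1)) ĉ^(u)_{L,k,p}`. -/
def dBetaU (L : ℕ) (γ : ℕ → UIdx P → ℝ) (lam : ℝ) (p : Fin P) (t : ℕ) : ℝ :=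
  ∑ k ∈ Finset.Icc 1 (numK L),
    (haarPsi L L k t - haarPsi L L k (t - 1)) * hardThreshold lam (coefU L γ L k p)

/-- `Δβ̃^(s)_{t,p} = ∑_k (ψ_{L,k}(t-1) - ψ_{L,k}(t-2)) ĉ^(s)_{L,k,p}`. -/
def dBetaS (L : ℕ) (γ : ℕ → UIdx P → ℝ) (lam : ℝ) (p : Fin P) (t : ℕ) : ℝ :=
  ∑ k ∈ Finset.Icc 1 (numK L),
    (haarPsi L L k (t - 1) - haarPsi L L k (t - 2)) * hardThreshold lam (coefS L γ L k p)

/-- The even time points `{2, 4, …, T-1}`. -/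
def evenTimes (L : ℕ) : Finset ℕ := (Finset.Icc 2 (periods L)).filter Even

/-- The complement of the even time points in `{2, …, T}`. -/
def oddTimes (L : ℕ) : Finset ℕ := Finset.Icc 2 (periods L) \ evenTimes L

open Classical in
/-- The number of time points `t ≤ s` at which a jump `β_{t,p} ≠ β_{t-1,p}` is detected. -/
def detectedUpTo (L : ℕ) (γ : ℕ → UIdx P → ℝ) (lam : ℝ) (p : Fin P) (s : ℕ) : ℕ :=
  ((evenTimes L).filter (fun t => t ≤ s ∧ dBetaU L γ lam p t ≠ 0)).card +
    ((oddTimes L).filter (fun t => t ≤ s ∧ dBetaS L γ lam p t ≠ 0)).card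

open Classical in
/-- The estimated number of jumps `S̃_p`. -/
def jumpCount (L : ℕ) (γ : ℕ → UIdx P → ℝ) (lam : ℝ) (p : Fin P) : ℕ :=
  ((evenTimes L).filter (fun t => dBetaU L γ lam p t ≠ 0)).card +
    ((oddTimes L).filter (fun t => dBetaS L γ lam p t ≠ 0)).card

/-- The estimated `j`-th jump location `τ̃_{j,p}`. A location is the last period before the
change, so a change detected at time `t` (a nonzero estimate of `β_{t,p} - β_{t-1,p}`) gives the
location `t - 1`: this is the least `s` for which exactly `j` changes are detected up to `s + 1`. -/
def jumpLoc (L : ℕ) (γ : ℕ → UIdx P → ℝ) (lam : ℝ) (p : Fin P) (j : ℕ) : ℕ :=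
  sInf {s | j = detectedUpTo L γ lam p (s + 1)}

end sample

/-! ## The model and the assumptions

All objects are sequences in `r : ℕ`: the `r`-th sample has `n r` individuals and
`periods (L r)` time periods. -/

/-- `T = 2^(L-1) + 1` with `L ≥ 2`; `n → ∞`, and `T` is fixed or tends to infinity
with `log(T)^ε / n → 0` for all `ε > 0`. -/
structure AssumptionA (n L : ℕ → ℕ) : Prop where
  n_pos : ∀ r, 1 ≤ n r
  two_le_L : ∀ r, 2 ≤ L r
  n_tendsto : Tendsto n atTop atTop
  T_regime : (∃ L₀, ∀ r, L r = L₀) ∨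
    (Tendsto L atTop atTop ∧ ∀ ε : ℝ, 0 < ε →
      Tendsto (fun r => Real.log (periods (L r) : ℝ) ^ ε / (n r : ℝ)) atTop (𝓝 0))

/-- The slopes: `β_{t,p} = ∑_{j=1}^{S_p+1} 𝟏(τ_{j-1,p} < t ≤ τ_{j,p}) β_{τ_{j,p},p}` with
`0 = τ_{0,p} < τ_{1,p} < ⋯ < τ_{S_p,p} < τ_{S_p+1,p} = T`. -/
structure PiecewiseConstant {P : ℕ} (L : ℕ) (S : Fin P → ℕ) (τ : Fin P → ℕ → ℕ)
    (β : ℕ → Fin P → ℝ) : Prop where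
  zero : ∀ p, τ p 0 = 0
  last : ∀ p, τ p (S p + 1) = periods L
  lt : ∀ p, ∀ j ≤ S p, τ p j < τ p (j + 1)
  slope : ∀ p, ∀ t ∈ Finset.Icc 1 (periods L),
    β t p = ∑ j ∈ Finset.Icc 1 (S p + 1),
      if τ p (j - 1) < t ∧ t ≤ τ p j then β (τ p j) p else 0

section assumptions

variable {Ω : Type*} [MeasurableSpace Ω] {P : ℕ}

/-- `Y_{it} = μ + X_{it}' β_t + α_i + θ_t + e_{it}`; the effects `α_i` and `θ_t` may be random. -/
structure PanelModel (n L : ℕ) (β : ℕ → Fin P → ℝ) (μ₀ : ℝ) (α θ : ℕ → Ω → ℝ)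
    (X : ℕ → ℕ → Ω → Fin P → ℝ) (Z : ℕ → ℕ → Ω → UIdx P → ℝ) (e Y : ℕ → ℕ → Ω → ℝ) : Prop where
  measurable_X : ∀ i ∈ Finset.Icc 1 n, ∀ t ∈ Finset.Icc 1 (periods L), Measurable (X i t)
  measurable_Z : ∀ i ∈ Finset.Icc 1 n, ∀ t ∈ Finset.Icc 2 (periods L), Measurable (Z i t)
  measurable_e : ∀ i ∈ Finset.Icc 1 n, ∀ t ∈ Finset.Icc 1 (periods L), Measurable (e i t)
  model : ∀ i ∈ Finset.Icc 1 n, ∀ t ∈ Finset.Icc 1 (periods L), ∀ ω,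
    Y i t ω = μ₀ + X i t ω ⬝ᵥ β t + α i ω + θ t ω + e i t ω

/-- Regressors and instruments: `E(Z_{it} Δe_{it}) = 0`; a uniform lower bound `c > 0` for the
matrices `Q_{l,m}` of all blocks, almost surely for all late samples, namely `‖Q_{l,m} v‖ ≥ c ‖v‖`
(for a symmetric positive definite matrix: its least eigenvalue is at least `c`); and uniformly
bounded fourth moments of the Euclidean norms of `Z_{it}` and `(X_{it}', -X_{i,t-1}', 1)'`. -/
structure AssumptionB (μ : Measure Ω) (n L : ℕ → ℕ) (X : ℕ → ℕ → ℕ → Ω → Fin P → ℝ)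
    (Z : ℕ → ℕ → ℕ → Ω → UIdx P → ℝ) (e : ℕ → ℕ → ℕ → Ω → ℝ) : Prop where
  exogeneity : ∀ r, ∀ i ∈ Finset.Icc 1 (n r), ∀ t ∈ Finset.Icc 2 (periods (L r)), ∀ q,
    Integrable (fun ω => Z r i t ω q * (e r i t ω - e r i (t - 1) ω)) μ ∧
      ∫ ω, Z r i t ω q * (e r i t ω - e r i (t - 1) ω) ∂μ = 0
  lower_bound : ∃ c : ℝ, 0 < c ∧ ∀ᶠ r in atTop, ∀ᵐ ω ∂μ,
    ∀ l ∈ Finset.Icc 1 (L r), ∀ m ∈ Finset.Icc 1 (2 ^ (l - 1)), ∀ v : UIdx P → ℝ,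
      c ^ 2 * (v ⬝ᵥ v) ≤
        (Qavg (n r) (L r) (fun i t => X r i t ω) (fun i t => Z r i t ω) l m *ᵥ v) ⬝ᵥ
          (Qavg (n r) (L r) (fun i t => X r i t ω) (fun i t => Z r i t ω) l m *ᵥ v)
  moments : ∃ M : ℝ, ∀ r, ∀ i ∈ Finset.Icc 1 (n r), ∀ t ∈ Finset.Icc 2 (periods (L r)),
    Integrable (fun ω => (Z r i t ω ⬝ᵥ Z r i t ω) ^ 2) μ ∧
    ∫ ω, (Z r i t ω ⬝ᵥ Z r i t ω) ^ 2 ∂μ ≤ M ∧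
    Integrable (fun ω => (regU (fun i t => X r i t ω) i t ⬝ᵥ
      regU (fun i t => X r i t ω) i t) ^ 2) μ ∧
    ∫ ω, (regU (fun i t => X r i t ω) i t ⬝ᵥ regU (fun i t => X r i t ω) i t) ^ 2 ∂μ ≤ M

/-- `∑_{i=1}^n ∑_{t=s+1}^{s'} Z_{it,q} Δe_{it}`. -/
def scoreSum (n : ℕ) (Z : ℕ → ℕ → Ω → UIdx P → ℝ) (e : ℕ → ℕ → Ω → ℝ) (s s' : ℕ) (q : UIdx P)
    (ω : Ω) : ℝ :=
  ∑ i ∈ Finset.Icc 1 n, ∑ t ∈ Finset.Icc (s + 1) s', Z i t ω q * (e i t ω - e i (t - 1) ω)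

/-- `σ²_{n,s,s';q} = (n(s'-s+1))⁻¹ E[(∑_{i=1}^n ∑_{t=s+1}^{s'} Z_{it,q} Δe_{it})²]`. -/
def scoreVar (μ : Measure Ω) (n : ℕ) (Z : ℕ → ℕ → Ω → UIdx P → ℝ) (e : ℕ → ℕ → Ω → ℝ)
    (s s' : ℕ) (q : UIdx P) : ℝ :=
  ((n : ℝ) * ((s' : ℝ) - s + 1))⁻¹ * ∫ ω, scoreSum n Z e s s' q ω ^ 2 ∂μ

/-- Weak dependence and exponential tails with exponent `δ₂`. -/
structure AssumptionC (μ : Measure Ω) (n L : ℕ → ℕ) (Z : ℕ → ℕ → ℕ → Ω → UIdx P → ℝ)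
    (e : ℕ → ℕ → ℕ → Ω → ℝ) (δ₂ : ℝ) : Prop where
  delta_pos : 0 < δ₂
  variance : ∃ M : ℝ, ∀ r s s', 1 ≤ s → s < s' → s' ≤ periods (L r) → ∀ q,
    Integrable (fun ω => scoreSum (n r) (Z r) (e r) s s' q ω ^ 2) μ ∧
      scoreVar μ (n r) (Z r) (e r) s s' q ≤ M
  tail : ∃ δ₀ δ₁ : ℝ, 0 < δ₀ ∧ 0 < δ₁ ∧
    ∀ r s s', 1 ≤ s → s < s' → s' ≤ periods (L r) → ∀ q, ∀ c : ℝ, 0 < c →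
      μ.real {ω | c * √(scoreVar μ (n r) (Z r) (e r) s s' q) ≤
          (√((n r : ℝ) * ((s' : ℝ) - s + 1)))⁻¹ * |scoreSum (n r) (Z r) (e r) s s' q ω|} ≤
        δ₀ * Real.exp (-δ₁ * c ^ δ₂)

end assumptions

/-- `n / log(T-1)^(2/δ₂)`. -/
def effSize (n L : ℕ) (δ₂ : ℝ) : ℝ :=
  (n : ℝ) / Real.log ((periods L : ℝ) - 1) ^ (2 / δ₂)

/-- Minimal jump size: for some `c > 0`, all jumps satisfy
`(n / log(T-1)^(2/δ₂))^(κ/2) |β_{τ_{j+1,p},p} - β_{τ_{j,p},p}| > c` in all late samples. -/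
def AssumptionD {P : ℕ} (n L : ℕ → ℕ) (S : ℕ → Fin P → ℕ) (τ : ℕ → Fin P → ℕ → ℕ)
    (β : ℕ → ℕ → Fin P → ℝ) (δ₂ κ : ℝ) : Prop :=
  ∃ c : ℝ, 0 < c ∧ ∀ᶠ r in atTop, ∀ p, ∀ j ∈ Finset.Icc 1 (S r p),
    c < effSize (n r) (L r) δ₂ ^ (κ / 2) * |β r (τ r p (j + 1)) p - β r (τ r p j) p|

end SAW

end

/-! # Consistency of jump detection by the structure-adapted wavelet estimator

The wavelet basis `W_{l,k}` has as many members as there are periods, and it is complete: a family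
of vectors `ρ_t` with `∑ₜ ρ_t W_{l,k}(t) = 0` for all `l, k` vanishes
(`IsSAWBasis.blockSum_eq_zero`). Going down the dyadic tree, the sum over a block is zero, its two
halves carry `v` and `-v`, and orthogonality to the basis function of the block gives
`v (A_{l,2k-1} + A_{l,2k}) = 0`, where the sum of the two matrices is invertible. Applied to the
sums of `Z_{it}` times the IV residual over `i`, this says that `γ̃_t` is the IV estimator computed
from period `t` alone. As blocks of the finest level are single periods, the eigenvalue condition
bounds `γ̃_t - γ_t` by a constant multiple of the score `n⁻¹ ∑ᵢ Z_{it} Δe_{it}`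
(`IsIVEstimator.error_bound`).

The detected changes depend on the coefficients of the finest level only, and these are
`(2(T-1))^(-1/2)` times the differences of `γ̃` between the periods `2k` and `2k + 1`. Their true
values are multiples of `β_{2k} - β_{2k+1}` (shifted) and `β_{2k-1} - β_{2k}` (unshifted), so that
every period `t ≥ 2` is tested by exactly one coefficient. If all coefficients have noise at most
`λ` and nonzero signals above `2λ`, thresholding finds precisely the true jumps
(`detectedUpTo_eq`), and both the number and the locations of the jumps are exact. The signals
exceed `2λ` in late samples by the minimal jump size, and the noise exceeds `λ` with probability
at most a constant times `(T-1)^(1 - y)` with `y → ∞`, by the union bound over the periods and the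
exponential tails (`tendsto_card_mul_exp_tail`). As `T - 1 ≥ 2`, this tends to zero whether or not
`T` grows.

The estimators need not be measurable in `ω`; all bounds are on outer measures of complements.
-/

/-! ### Completeness of the wavelet basis and the period-wise IV estimator -/

namespace SAW

lemma periods_sub_one (L : ℕ) : (periods L : ℝ) - 1 = 2 ^ (L - 1) := by
  simp [periods]

lemma haarInd_split {L l : ℕ} (hlL : l + 1 ≤ L) (k s : ℕ) :
    haarInd L l (k + 1) s =
      haarInd L (l + 1) (2 * (k + 1) - 1) s + haarInd L (l + 1) (2 * (k + 1)) s := by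
  have hp : 2 ^ (L - l) = 2 * 2 ^ (L - (l + 1)) := by
    rw [← pow_succ']; congr 1; omega
  have hB : 0 < 2 ^ (L - (l + 1)) := by positivity
  unfold haarInd
  rw [hp]
  generalize 2 ^ (L - (l + 1)) = B at *
  have e1 : 2 * (k + 1) - 1 = 2 * k + 1 := by omega
  have e2 : 2 * B * (k + 1 - 1) = 2 * (B * k) := by simp; ring
  have e3 : 2 * B * (k + 1) = 2 * (B * k) + 2 * B := by ring
  have e4 : B * (2 * k + 1 - 1) = 2 * (B * k) := by simp; ring
  have e5 : B * (2 * k + 1) = 2 * (B * k) + B := by ring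
  have e6 : B * (2 * (k + 1)) = 2 * (B * k) + 2 * B := by ring
  have e7 : B * (2 * (k + 1) - 1) = 2 * (B * k) + B := by rw [e1, e5]
  rw [e7, e1, e2, e3, e4, e6]
  generalize B * k = C
  split_ifs <;> first | omega | simp

lemma haarInd_root {L s : ℕ} (hs : s ∈ Finset.Icc 1 (2 ^ (L - 1))) : haarInd L 1 1 s = 1 := by
  rw [Finset.mem_Icc] at hs
  simp only [haarInd]
  rw [if_pos]
  simpa using hs

lemma haarInd_top {L m : ℕ} (hm : 1 ≤ m) (s : ℕ) :
    haarInd L L m s = if s = m then 1 else 0 := by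
  simp only [haarInd, Nat.sub_self, pow_zero, one_mul]
  exact if_congr (by omega) rfl rfl

lemma haarPsi_top {L k : ℕ} (hk : 1 ≤ k) (s : ℕ) :
    haarPsi L L k s = √((2 : ℝ) ^ (L - 2)) *
      ((if s = 2 * k - 1 then 1 else 0) - (if s = 2 * k then 1 else 0)) := by
  rw [haarPsi, haarInd_top (by omega), haarInd_top (by omega)]

section sample

variable {P : ℕ} {n L : ℕ} {X : ℕ → ℕ → Fin P → ℝ} {Z : ℕ → ℕ → UIdx P → ℝ}
  {A : ℕ → ℕ → Matrix (UIdx P) (UIdx P) ℝ}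

/-- Both matrices attached to the two halves of a block are right multiples of one inverse square
root, so their sum is `M R` with `R R M = 1`, which is invertible. -/
lemma IsSAWBasis.eq_zero_of_vecMul_add (hA : IsSAWBasis n L X Z A) {l k : ℕ}
    (hl : l ∈ Finset.Icc 2 L) (hk : k ∈ Finset.Icc 1 (numK l)) {v : UIdx P → ℝ}
    (hv : v ᵥ* (A l (2 * k - 1) + A l (2 * k)) = 0) : v = 0 := by
  obtain ⟨R, hR, h1, h2⟩ := hA.level l hl k hk
  rw [h1, h2, ← add_mul] at hv
  set M := (Qmat n L X Z l (2 * k - 1))⁻¹ + (Qmat n L X Z l (2 * k))⁻¹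
  have hRM : M * R * R = 1 := by
    rw [mul_assoc]; exact mul_eq_one_comm.mp hR
  rw [← Matrix.vecMul_one v, ← hRM, ← Matrix.vecMul_vecMul, hv, Matrix.zero_vecMul]

lemma IsSAWBasis.eq_zero_of_vecMul (hA : IsSAWBasis n L X Z A) {v : UIdx P → ℝ}
    (hv : v ᵥ* A 1 1 = 0) : v = 0 := by
  have h := hA.level_one
  rw [IsInvSqrt, mul_assoc] at h
  rw [← Matrix.vecMul_one v, ← h, ← Matrix.vecMul_vecMul, hv, Matrix.zero_vecMul]

/-- The basis is complete: vectors `ρ_t` that are orthogonal to every `W_{l,k}` have vanishing sums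
over all dyadic blocks. If the sum over a block is zero, its halves contribute `v` and `-v`, and
orthogonality to the basis function on this block says `v (A_{l,2k-1} + A_{l,2k}) = 0`. -/
lemma IsSAWBasis.blockSum_eq_zero (hA : IsSAWBasis n L X Z A) {ρ : ℕ → UIdx P → ℝ}
    (hρ : ∀ l ∈ Finset.Icc 1 L, ∀ k ∈ Finset.Icc 1 (numK l),
      ∑ t ∈ Finset.Icc 2 (periods L), ρ t ᵥ* basisW L A l k t = 0)
    {l : ℕ} (hl : 1 ≤ l) (hlL : l ≤ L) :
    ∀ m ∈ Finset.Icc 1 (2 ^ (l - 1)),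
      ∑ t ∈ Finset.Icc 2 (periods L), haarInd L l m (t - 1) • ρ t = 0 := by
  induction l, hl using Nat.le_induction with
  | base =>
    intro m hm
    obtain rfl : m = 1 := by simpa using hm
    have h := hρ 1 (by simp; omega) 1 (by simp [numK])
    simp only [basisW, if_true, ← Matrix.sum_vecMul] at h
    rw [← hA.eq_zero_of_vecMul h]
    refine Finset.sum_congr rfl fun t ht => ?_
    rw [haarInd_root, one_smul]
    simp only [Finset.mem_Icc, periods] at ht ⊢
    omega
  | succ l hl ih =>
    intro m hm
    rw [Finset.mem_Icc] at hm
    obtain ⟨k, hk⟩ : ∃ k, m = 2 * (k + 1) - 1 ∨ m = 2 * (k + 1) := ⟨(m - 1) / 2, by omega⟩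
    have hp : 2 ^ (l + 1 - 1) = 2 * 2 ^ (l - 1) := by
      rw [← pow_succ']; congr 1; omega
    have hkm : k + 1 ≤ 2 ^ (l - 1) := by omega
    have hpar := ih (by omega) (k + 1) (by simp; omega)
    simp only [haarInd_split hlL, add_smul, Finset.sum_add_distrib] at hpar
    have hl2 : l + 1 ∈ Finset.Icc 2 L := by simp; omega
    have hk2 : k + 1 ∈ Finset.Icc 1 (numK (l + 1)) := by
      have : l + 1 ≠ 1 := by omega
      simp only [numK, this, if_false, Finset.mem_Icc]
      have : l + 1 - 2 = l - 1 := by omega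
      rw [this]; omega
    have h := hρ (l + 1) (by simp; omega) (k + 1) hk2
    set u := ∑ t ∈ Finset.Icc 2 (periods L), haarInd L (l + 1) (2 * (k + 1) - 1) (t - 1) • ρ t
      with hu
    set v := ∑ t ∈ Finset.Icc 2 (periods L), haarInd L (l + 1) (2 * (k + 1)) (t - 1) • ρ t
      with hv
    have hs : √((2 : ℝ) ^ (l + 1 - 2)) ≠ 0 := by positivity
    have h' : √((2 : ℝ) ^ (l + 1 - 2)) •
        (u ᵥ* A (l + 1) (2 * (k + 1) - 1) - v ᵥ* A (l + 1) (2 * (k + 1))) = 0 := by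
      rw [← h, hu, hv]
      have : l + 1 ≠ 1 := by omega
      simp only [basisW, this, if_false, haarH, Matrix.vecMul_sub, Matrix.vecMul_smul,
        Matrix.sum_vecMul, Matrix.smul_vecMul, Finset.sum_sub_distrib, mul_smul,
        ← Finset.smul_sum, smul_sub]
    have h'' := (smul_eq_zero.mp h').resolve_left hs
    have hvu : v = -u := by rw [eq_neg_iff_add_eq_zero, add_comm]; exact hpar
    rw [hvu, Matrix.neg_vecMul, sub_neg_eq_add, ← Matrix.vecMul_add] at h''
    have hu0 := hA.eq_zero_of_vecMul_add hl2 hk2 h''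
    rcases hk with rfl | rfl
    · exact hu0
    · rw [← hv, hvu, hu0, neg_zero]

/-- The IV residuals are orthogonal to the instruments period by period. -/
lemma IsIVEstimator.period_moment {dY : ℕ → ℕ → ℝ} {b : ℕ → ℕ → UIdx P → ℝ}
    (hb : IsIVEstimator n L X Z A dY b) (hA : IsSAWBasis n L X Z A) (hn : 1 ≤ n) (hL : 1 ≤ L)
    {t : ℕ} (ht : t ∈ Finset.Icc 2 (periods L)) :
    ∑ i ∈ Finset.Icc 1 n, (dY i t - regU X i t ⬝ᵥ gammaTilde L A b t) • Z i t = 0 := by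
  set ρ : ℕ → UIdx P → ℝ := fun t =>
    ∑ i ∈ Finset.Icc 1 n, (dY i t - regU X i t ⬝ᵥ gammaTilde L A b t) • Z i t with hρ
  have key : ∀ l ∈ Finset.Icc 1 L, ∀ k ∈ Finset.Icc 1 (numK l),
      ∑ t ∈ Finset.Icc 2 (periods L), ρ t ᵥ* basisW L A l k t = 0 := by
    intro l hl k hk
    have hc : ((n : ℝ) * ((periods L : ℝ) - 1))⁻¹ ≠ 0 := by
      rw [periods_sub_one]
      have : (0 : ℝ) < n := by exact_mod_cast hn
      positivity
    have h := (smul_eq_zero.mp (hb l hl k hk)).resolve_left hc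
    rw [Finset.sum_comm] at h
    rw [← h]
    refine Finset.sum_congr rfl fun t _ => ?_
    simp only [hρ, Matrix.sum_vecMul, Matrix.smul_vecMul, gammaTilde, modX, modZ,
      dotProduct_sum, Matrix.dotProduct_mulVec]
  rw [Finset.mem_Icc, periods] at ht
  have h := hA.blockSum_eq_zero key hL le_rfl (t - 1) (by simp; omega)
  rw [Finset.sum_eq_single_of_mem t (by simp [periods]; omega)] at h
  · rwa [haarInd_top (by omega), if_pos rfl, one_smul] at h
  · intro s hs hst
    rw [Finset.mem_Icc] at hs
    rw [haarInd_top (by omega), if_neg (by omega), zero_smul]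

/-- A block of the finest level is a single period. -/
lemma Qavg_top {t : ℕ} (ht : t ∈ Finset.Icc 2 (periods L)) :
    Qavg n L X Z L (t - 1) =
      (n : ℝ)⁻¹ • ∑ i ∈ Finset.Icc 1 n, Matrix.vecMulVec (Z i t) (regU X i t) := by
  have hf : (Finset.Icc 2 (periods L)).filter (fun s => haarH L L (t - 1) s ≠ 0) = {t} := by
    ext s
    rw [Finset.mem_Icc] at ht
    have hs : √((2 : ℝ) ^ (L - 2)) ≠ 0 := by positivity
    simp only [haarH, haarInd_top (show 1 ≤ t - 1 by omega), Finset.mem_filter, Finset.mem_Icc,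
      Finset.mem_singleton, ne_eq, mul_eq_zero, hs, false_or, ite_eq_right_iff, one_ne_zero,
      imp_false, not_not]
    omega
  rw [Qavg, hf]
  simp

/-- The estimation error of `γ̃_t` is controlled by the score of period `t` alone: with
`Q = n⁻¹ ∑ᵢ Z_{it} X_{it}'`, the period moments say `Q (γ̃_t - γ_t) = n⁻¹ ∑ᵢ Z_{it} Δe_{it}`. -/
lemma IsIVEstimator.error_bound {dY ε : ℕ → ℕ → ℝ} {b : ℕ → ℕ → UIdx P → ℝ}
    (hb : IsIVEstimator n L X Z A dY b) (hA : IsSAWBasis n L X Z A) (hn : 1 ≤ n) (hL : 1 ≤ L)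
    {γ : ℕ → UIdx P → ℝ}
    (hdY : ∀ i ∈ Finset.Icc 1 n, ∀ t ∈ Finset.Icc 2 (periods L),
      dY i t = regU X i t ⬝ᵥ γ t + ε i t) {c : ℝ} (hc : 0 < c)
    (hQ : ∀ m ∈ Finset.Icc 1 (2 ^ (L - 1)), ∀ v : UIdx P → ℝ,
      c ^ 2 * (v ⬝ᵥ v) ≤ (Qavg n L X Z L m *ᵥ v) ⬝ᵥ (Qavg n L X Z L m *ᵥ v))
    {B : ℝ} (hB : 0 ≤ B) {t : ℕ} (ht : t ∈ Finset.Icc 2 (periods L))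
    (hε : ∀ q, |∑ i ∈ Finset.Icc 1 n, Z i t q * ε i t| ≤ B) (q : UIdx P) :
    |gammaTilde L A b t q - γ t q| ≤ √(Fintype.card (UIdx P)) * B / (c * n) := by
  have hn0 : (0 : ℝ) < n := by exact_mod_cast hn
  set v := gammaTilde L A b t - γ t with hv
  have h0 := hb.period_moment hA hn hL ht
  have hQv : Qavg n L X Z L (t - 1) *ᵥ v =
      (n : ℝ)⁻¹ • ∑ i ∈ Finset.Icc 1 n, ε i t • Z i t := by
    rw [Qavg_top ht, Matrix.smul_mulVec, Matrix.sum_mulVec]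
    congr 1
    rw [← sub_eq_zero, ← neg_eq_zero, ← h0, ← Finset.sum_sub_distrib, ← Finset.sum_neg_distrib]
    refine Finset.sum_congr rfl fun i hi => ?_
    rw [hdY i hi t ht, Matrix.vecMulVec_mulVec, op_smul_eq_smul, hv, dotProduct_sub,
      ← sub_smul, ← neg_smul]
    congr 1
    ring
  have hm : t - 1 ∈ Finset.Icc 1 (2 ^ (L - 1)) := by
    rw [Finset.mem_Icc, periods] at ht
    simp; omega
  have h1 := hQ (t - 1) hm v
  rw [hQv] at h1
  have h2 : (v q) ^ 2 ≤ v ⬝ᵥ v := by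
    rw [pow_two]
    exact Finset.single_le_sum (f := fun q => v q * v q) (fun _ _ => mul_self_nonneg _)
      (Finset.mem_univ q)
  have h3 : ((n : ℝ)⁻¹ • ∑ i ∈ Finset.Icc 1 n, ε i t • Z i t) ⬝ᵥ
      ((n : ℝ)⁻¹ • ∑ i ∈ Finset.Icc 1 n, ε i t • Z i t) ≤
      Fintype.card (UIdx P) * ((n : ℝ)⁻¹ * B) ^ 2 := by
    rw [dotProduct, ← nsmul_eq_mul, ← Finset.card_univ]
    refine Finset.sum_le_card_nsmul _ _ _ fun q _ => ?_
    rw [← pow_two]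
    refine sq_le_sq' ?_ ?_
    all_goals
      have := hε q
      have e : (∑ i ∈ Finset.Icc 1 n, ε i t • Z i t) q =
          ∑ i ∈ Finset.Icc 1 n, Z i t q * ε i t := by
        simp [Finset.sum_apply, mul_comm]
      rw [Pi.smul_apply, e, smul_eq_mul]
      have hh := abs_le.mp this
    · rw [← mul_neg]; exact mul_le_mul_of_nonneg_left hh.1 (by positivity)
    · exact mul_le_mul_of_nonneg_left hh.2 (by positivity)
  have h4 : c ^ 2 * (v q) ^ 2 ≤ Fintype.card (UIdx P) * ((n : ℝ)⁻¹ * B) ^ 2 :=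
    (mul_le_mul_of_nonneg_left h2 (by positivity)).trans (h1.trans h3)
  change |v q| ≤ _
  rw [← sq_le_sq₀ (abs_nonneg _) (by positivity), sq_abs, div_pow, mul_pow, mul_pow,
    Real.sq_sqrt (by positivity), le_div_iff₀ (by positivity)]
  have : (Fintype.card (UIdx P) : ℝ) * ((n : ℝ)⁻¹ * B) ^ 2 * n ^ 2 =
      Fintype.card (UIdx P) * B ^ 2 := by field_simp
  rw [← this]
  nlinarith [mul_le_mul_of_nonneg_right h4 (sq_nonneg (n : ℝ))]

end sample

end SAW

/-! ### Coefficients of the finest level and detection of jumps -/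

namespace SAW

lemma numK_of_two_le {L : ℕ} (hL : 2 ≤ L) : numK L = 2 ^ (L - 2) := by
  rw [numK, if_neg (by omega)]

lemma periods_eq_two_mul {L : ℕ} (hL : 2 ≤ L) : periods L = 2 * 2 ^ (L - 2) + 1 := by
  rw [periods, ← pow_succ']; congr 2; omega

/-- At time `2k`, or at time `2k + 1` for the shifted basis, only the `k`-th function of the finest
level changes its value between the current and the preceding period. -/
lemma sum_haarPsi_top_diff_mul {L k : ℕ} (hk : k ∈ Finset.Icc 1 (numK L)) (f : ℕ → ℝ) :
    ∑ k' ∈ Finset.Icc 1 (numK L), (haarPsi L L k' (2 * k) - haarPsi L L k' (2 * k - 1)) * f k' =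
      -2 * √((2 : ℝ) ^ (L - 2)) * f k := by
  rw [Finset.mem_Icc] at hk
  rw [Finset.sum_eq_single_of_mem k (by simpa using hk)]
  · rw [haarPsi_top hk.1, haarPsi_top hk.1, if_neg (by omega), if_pos rfl, if_pos rfl,
      if_neg (by omega)]
    ring
  · intro k' hk' hne
    rw [Finset.mem_Icc] at hk'
    rw [haarPsi_top hk'.1, haarPsi_top hk'.1, if_neg (by omega), if_neg (by omega),
      if_neg (by omega), if_neg (by omega)]
    ring

/-- The factor `√(2^(L-2)) / (T-1) = (2(T-1))^(-1/2)` of the coefficients at the finest level. -/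
noncomputable def topScale (L : ℕ) : ℝ := (√(2 * ((periods L : ℝ) - 1)))⁻¹

lemma topScale_pos (L : ℕ) : 0 < topScale L := by
  rw [topScale, periods_sub_one]
  positivity

lemma topScale_eq {L : ℕ} (hL : 2 ≤ L) :
    topScale L = ((periods L : ℝ) - 1)⁻¹ * √((2 : ℝ) ^ (L - 2)) := by
  obtain ⟨m, rfl⟩ := Nat.exists_eq_add_of_le hL
  have e1 : 2 + m - 1 = m + 1 := by omega
  have e2 : 2 + m - 2 = m := by omega
  rw [topScale, periods_sub_one, e1, e2]
  have e3 : (2 : ℝ) * 2 ^ (m + 1) = 2 ^ m * 2 ^ 2 := by ring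
  have h : √((2 : ℝ) ^ m) * √(2 ^ m) = 2 ^ m := Real.mul_self_sqrt (by positivity)
  rw [e3, Real.sqrt_mul (by positivity), Real.sqrt_sq (by positivity), pow_succ]
  have h0 : √((2 : ℝ) ^ m) ≠ 0 := by positivity
  generalize √((2 : ℝ) ^ m) = x at h h0
  rw [← h]
  field_simp

section sample

variable {P : ℕ} {L k : ℕ}

lemma coefS_top (hL : 2 ≤ L) (hk : k ∈ Finset.Icc 1 (numK L)) (γ : ℕ → UIdx P → ℝ) (p : Fin P) :
    coefS L γ L k p = topScale L * (γ (2 * k) (Sum.inl p) - γ (2 * k + 1) (Sum.inl p)) := by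
  rw [numK_of_two_le hL, Finset.mem_Icc] at hk
  rw [coefS, topScale_eq hL, mul_assoc]
  congr 1
  have h : ∀ t ∈ Finset.Icc 2 (periods L), haarPsi L L k (t - 1) * γ t (Sum.inl p) =
      √((2 : ℝ) ^ (L - 2)) * ((if t = 2 * k then γ t (Sum.inl p) else 0) -
        (if t = 2 * k + 1 then γ t (Sum.inl p) else 0)) := by
    intro t ht
    rw [Finset.mem_Icc] at ht
    rw [haarPsi_top hk.1, mul_assoc, sub_mul, ite_mul, ite_mul, one_mul, zero_mul]
    congr 2
    · exact if_congr (by omega) rfl rfl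
    · exact if_congr (by omega) rfl rfl
  rw [Finset.sum_congr rfl h, ← Finset.mul_sum, Finset.sum_sub_distrib,
    Finset.sum_ite_eq', Finset.sum_ite_eq', if_pos, if_pos]
  all_goals rw [periods_eq_two_mul hL, Finset.mem_Icc]; omega

lemma coefU_top (hL : 2 ≤ L) (hk : k ∈ Finset.Icc 1 (numK L)) (γ : ℕ → UIdx P → ℝ) (p : Fin P) :
    coefU L γ L k p = topScale L *
      (γ (2 * k) (Sum.inr (Sum.inl p)) - γ (2 * k + 1) (Sum.inr (Sum.inl p))) := by
  rw [numK_of_two_le hL, Finset.mem_Icc] at hk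
  rw [coefU, topScale_eq hL, mul_assoc]
  congr 1
  have e : 2 * k - 1 + 1 = 2 * k := by omega
  have h : ∀ t ∈ Finset.Icc 1 (periods L - 1),
      haarPsi L L k t * γ (t + 1) (Sum.inr (Sum.inl p)) =
      √((2 : ℝ) ^ (L - 2)) * ((if t = 2 * k - 1 then γ (t + 1) (Sum.inr (Sum.inl p)) else 0) -
        (if t = 2 * k then γ (t + 1) (Sum.inr (Sum.inl p)) else 0)) := by
    intro t _
    rw [haarPsi_top hk.1, mul_assoc, sub_mul, ite_mul, ite_mul, one_mul, zero_mul]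
  rw [Finset.sum_congr rfl h, ← Finset.mul_sum, Finset.sum_sub_distrib,
    Finset.sum_ite_eq', Finset.sum_ite_eq', if_pos, if_pos, e]
  all_goals rw [periods_eq_two_mul hL, Finset.mem_Icc]; omega

lemma hardThreshold_ne_zero_iff {lam c : ℝ} (hlam : 0 ≤ lam) :
    hardThreshold lam c ≠ 0 ↔ lam < |c| := by
  unfold hardThreshold
  split_ifs with h
  · exact ⟨fun _ => h, fun _ => abs_pos.mp (hlam.trans_lt h)⟩
  · simp [h]

lemma dBetaU_ne_zero_iff (hL : 2 ≤ L) (hk : k ∈ Finset.Icc 1 (numK L)) (γ : ℕ → UIdx P → ℝ)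
    {lam : ℝ} (hlam : 0 ≤ lam) (p : Fin P) :
    dBetaU L γ lam p (2 * k) ≠ 0 ↔ lam < |topScale L *
      (γ (2 * k) (Sum.inr (Sum.inl p)) - γ (2 * k + 1) (Sum.inr (Sum.inl p)))| := by
  have hs : -2 * √((2 : ℝ) ^ (L - 2)) ≠ 0 := by simp
  rw [dBetaU, sum_haarPsi_top_diff_mul hk, mul_ne_zero_iff_left hs,
    hardThreshold_ne_zero_iff hlam, coefU_top hL hk]

lemma dBetaS_ne_zero_iff (hL : 2 ≤ L) (hk : k ∈ Finset.Icc 1 (numK L)) (γ : ℕ → UIdx P → ℝ)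
    {lam : ℝ} (hlam : 0 ≤ lam) (p : Fin P) :
    dBetaS L γ lam p (2 * k + 1) ≠ 0 ↔
      lam < |topScale L * (γ (2 * k) (Sum.inl p) - γ (2 * k + 1) (Sum.inl p))| := by
  have hs : -2 * √((2 : ℝ) ^ (L - 2)) ≠ 0 := by simp
  rw [dBetaS, show 2 * k + 1 - 1 = 2 * k by omega, show 2 * k + 1 - 2 = 2 * k - 1 by omega,
    sum_haarPsi_top_diff_mul hk, mul_ne_zero_iff_left hs, hardThreshold_ne_zero_iff hlam,
    coefS_top hL hk]

/-- If the noise in a coefficient is at most the threshold and a nonzero signal exceeds twice the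
threshold, then exactly the nonzero signals survive thresholding. -/
lemma threshold_detects_iff {s δ lam a b a' b' : ℝ} (hs : 0 < s)
    (ha : |a - a'| ≤ δ) (hb : |b - b'| ≤ δ) (hδ : s * (2 * δ) ≤ lam)
    (hsig : a' ≠ b' → 2 * lam < s * |a' - b'|) :
    lam < |s * (a - b)| ↔ a' ≠ b' := by
  rw [abs_mul, abs_of_pos hs]
  constructor
  · rintro h rfl
    have : |a - b| ≤ 2 * δ := by
      have := abs_sub (a - a') (b - a')
      rw [sub_sub_sub_cancel_right] at this
      linarith
    nlinarith
  · intro h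
    have h1 := hsig h
    have h2 : |a' - b'| ≤ |a - b| + 2 * δ := by
      calc |a' - b'| = |(a - b) - (a - a') + (b - b')| := by congr 1; ring
        _ ≤ |(a - b) - (a - a')| + |b - b'| := abs_add_le _ _
        _ ≤ |a - b| + |a - a'| + |b - b'| := by gcongr; exact abs_sub _ _
        _ ≤ _ := by linarith
    nlinarith [mul_le_mul_of_nonneg_left h2 hs.le]

namespace PiecewiseConstant

variable {S : Fin P → ℕ} {τ : Fin P → ℕ → ℕ} {β : ℕ → Fin P → ℝ}

lemma strictMonoOn (h : PiecewiseConstant L S τ β) (p : Fin P) :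
    StrictMonoOn (τ p) (Set.Iic (S p + 1)) :=
  strictMonoOn_of_lt_succ Set.ordConnected_Iic fun a _ _ hb => by
    have : a + 1 ≤ S p + 1 := by simpa using hb
    exact h.lt p a (by omega)

lemma slope_eq (h : PiecewiseConstant L S τ β) {p : Fin P} {j t : ℕ} (hj : j ≤ S p)
    (h1 : τ p j < t) (h2 : t ≤ τ p (j + 1)) : β t p = β (τ p (j + 1)) p := by
  have hT : τ p (j + 1) ≤ periods L := by
    rw [← h.last p]
    exact (h.strictMonoOn p).monotoneOn (by simp; omega) (by simp) (by omega)
  rw [h.slope p t (by simp; omega), Finset.sum_eq_single_of_mem (j + 1) (by simp; omega),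
    if_pos ⟨by simpa using h1, h2⟩]
  intro i hi hij
  rw [Finset.mem_Icc] at hi
  rw [if_neg]
  rintro ⟨h3, h4⟩
  rcases lt_or_gt_of_ne hij with hlt | hgt
  · have := (h.strictMonoOn p).monotoneOn (a := i) (b := j) (by simp; omega) (by simp; omega)
      (by omega)
    omega
  · have := (h.strictMonoOn p).monotoneOn (a := j + 1) (b := i - 1) (by simp; omega)
      (by simp; omega) (by omega)
    omega

/-- The slope changes exactly one period after the jump locations. -/
lemma slope_ne_iff (h : PiecewiseConstant L S τ β) {p : Fin P}
    (hne : ∀ j ∈ Finset.Icc 1 (S p), β (τ p (j + 1)) p ≠ β (τ p j) p) {t : ℕ}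
    (ht : t ∈ Finset.Icc 2 (periods L)) :
    β (t - 1) p ≠ β t p ↔ ∃ j ∈ Finset.Icc 1 (S p), τ p j + 1 = t := by
  rw [Finset.mem_Icc] at ht
  have hmono := h.strictMonoOn p
  obtain ⟨j, hj, h1, h2⟩ : ∃ j ≤ S p, τ p j < t ∧ t ≤ τ p (j + 1) := by
    classical
    have hex : ∃ j, t ≤ τ p (j + 1) := ⟨S p, by rw [h.last]; exact ht.2⟩
    refine ⟨Nat.find hex, Nat.find_min' hex (by rw [h.last]; exact ht.2), ?_, Nat.find_spec hex⟩
    rcases Nat.eq_zero_or_pos (Nat.find hex) with h0 | h0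
    · rw [h0, h.zero]; omega
    · have := Nat.find_min hex (m := Nat.find hex - 1) (by omega)
      rw [Nat.sub_add_cancel h0] at this
      omega
  rcases (show τ p j < t - 1 ∨ τ p j + 1 = t by omega) with h3 | h3
  · rw [h.slope_eq hj h1 h2, h.slope_eq hj h3 (by omega)]
    simp only [ne_eq, not_true_eq_false, false_iff, not_exists, not_and]
    intro i hi hit
    rw [Finset.mem_Icc] at hi
    have h4 := (hmono.lt_iff_lt (a := j) (b := i) (by simp; omega) (by simp; omega)).mp (by omega)
    have h5 := (hmono.lt_iff_lt (a := i) (b := j + 1) (by simp; omega) (by simp; omega)).mp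
      (by omega)
    omega
  · have hj1 : 1 ≤ j := by
      rcases Nat.eq_zero_or_pos j with rfl | h0
      · rw [h.zero] at h3; omega
      · exact h0
    have hjm : j ∈ Finset.Icc 1 (S p) := by simp; omega
    refine iff_of_true ?_ ⟨j, hjm, h3⟩
    rw [h.slope_eq hj h1 h2, show t - 1 = τ p j by omega]
    exact (hne j hjm).symm

end PiecewiseConstant

lemma jumpCount_eq_detectedUpTo (γ : ℕ → UIdx P → ℝ) (lam : ℝ) (p : Fin P) :
    jumpCount L γ lam p = detectedUpTo L γ lam p (periods L) := by
  unfold jumpCount detectedUpTo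
  congr 2
  all_goals
    refine Finset.filter_congr fun t ht => ?_
    have : t ≤ periods L := by
      simp only [oddTimes, evenTimes, Finset.mem_sdiff, Finset.mem_filter, Finset.mem_Icc] at ht
      exact ht.1.2
    simp [this]

variable {S : Fin P → ℕ} {τ : Fin P → ℕ → ℕ} {β : ℕ → Fin P → ℝ}

/-- On the event that all period-wise errors are at most `δ`, the changes detected up to time `s`
are exactly the true ones. -/
lemma detectedUpTo_eq (hL : 2 ≤ L) (h : PiecewiseConstant L S τ β) {γ γ' : ℕ → UIdx P → ℝ}
    {lam δ : ℝ} (hlam : 0 ≤ lam) {p : Fin P}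
    (hl : ∀ t ∈ Finset.Icc 2 (periods L), γ' t (Sum.inl p) = β t p)
    (hr : ∀ t ∈ Finset.Icc 2 (periods L), γ' t (Sum.inr (Sum.inl p)) = β (t - 1) p)
    (herr : ∀ t ∈ Finset.Icc 2 (periods L), ∀ q, |γ t q - γ' t q| ≤ δ)
    (hδ : topScale L * (2 * δ) ≤ lam)
    (hjump : ∀ j ∈ Finset.Icc 1 (S p),
      2 * lam < topScale L * |β (τ p (j + 1)) p - β (τ p j) p|) (s : ℕ) :
    detectedUpTo L γ lam p s = ((Finset.Icc 1 (S p)).filter (fun j => τ p j + 1 ≤ s)).card := by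
  classical
  have hne : ∀ j ∈ Finset.Icc 1 (S p), β (τ p (j + 1)) p ≠ β (τ p j) p := by
    intro j hj heq
    have := hjump j hj
    rw [heq, sub_self, abs_zero, mul_zero] at this
    linarith
  have hsig : ∀ t ∈ Finset.Icc 2 (periods L), β (t - 1) p ≠ β t p →
      2 * lam < topScale L * |β (t - 1) p - β t p| := by
    intro t ht hbt
    obtain ⟨j, hj, rfl⟩ := (h.slope_ne_iff hne ht).mp hbt
    rw [Finset.mem_Icc] at hj
    rw [h.slope_eq (j := j) (t := τ p j + 1) hj.2 (by omega) (h.lt p j hj.2), abs_sub_comm]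
    exact hjump j (by simpa using hj)
  have heven : ∀ t ∈ evenTimes L, (dBetaU L γ lam p t ≠ 0 ↔ β (t - 1) p ≠ β t p) := by
    intro t ht
    rw [evenTimes, Finset.mem_filter, Finset.mem_Icc] at ht
    obtain ⟨⟨h1, h2⟩, k, rfl⟩ := ht
    rw [periods_eq_two_mul hL] at h2
    have hk : k ∈ Finset.Icc 1 (numK L) := by
      rw [numK_of_two_le hL, Finset.mem_Icc]; omega
    rw [← two_mul] at *
    have m1 : 2 * k ∈ Finset.Icc 2 (periods L) := by
      rw [periods_eq_two_mul hL, Finset.mem_Icc]; omega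
    have m2 : 2 * k + 1 ∈ Finset.Icc 2 (periods L) := by
      rw [periods_eq_two_mul hL, Finset.mem_Icc]; omega
    rw [dBetaU_ne_zero_iff hL hk γ hlam]
    have e1 := herr _ m1 (Sum.inr (Sum.inl p))
    have e2 := herr _ m2 (Sum.inr (Sum.inl p))
    rw [hr _ m1] at e1
    rw [hr _ m2, Nat.add_sub_cancel] at e2
    exact threshold_detects_iff (topScale_pos L) e1 e2 hδ (hsig _ m1)
  have hodd : ∀ t ∈ oddTimes L, (dBetaS L γ lam p t ≠ 0 ↔ β (t - 1) p ≠ β t p) := by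
    intro t ht
    simp only [oddTimes, evenTimes, Finset.mem_sdiff, Finset.mem_filter, not_and,
      Nat.not_even_iff_odd] at ht
    obtain ⟨m2, h3⟩ := ht
    obtain ⟨k, rfl⟩ := h3 m2
    have m2' := m2
    rw [periods_eq_two_mul hL, Finset.mem_Icc] at m2'
    have hk : k ∈ Finset.Icc 1 (numK L) := by
      rw [numK_of_two_le hL, Finset.mem_Icc]; omega
    have m1 : 2 * k ∈ Finset.Icc 2 (periods L) := by
      rw [periods_eq_two_mul hL, Finset.mem_Icc]; omega
    rw [dBetaS_ne_zero_iff hL hk γ hlam]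
    have e1 := herr _ m1 (Sum.inl p)
    have e2 := herr _ m2 (Sum.inl p)
    rw [hl _ m1] at e1
    rw [hl _ m2] at e2
    have := hsig _ m2
    rw [Nat.add_sub_cancel] at this ⊢
    exact threshold_detects_iff (topScale_pos L) e1 e2 hδ this
  have hE : (evenTimes L).filter (fun t => t ≤ s ∧ dBetaU L γ lam p t ≠ 0) =
      (evenTimes L).filter (fun t => t ≤ s ∧ β (t - 1) p ≠ β t p) :=
    Finset.filter_congr fun t ht => and_congr_right fun _ => heven t ht
  have hO : (oddTimes L).filter (fun t => t ≤ s ∧ dBetaS L γ lam p t ≠ 0) =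
      (oddTimes L).filter (fun t => t ≤ s ∧ β (t - 1) p ≠ β t p) :=
    Finset.filter_congr fun t ht => and_congr_right fun _ => hodd t ht
  have hdisj : Disjoint (evenTimes L) (oddTimes L) := Finset.disjoint_sdiff
  have hunion : evenTimes L ∪ oddTimes L = Finset.Icc 2 (periods L) :=
    Finset.union_sdiff_of_subset (Finset.filter_subset _ _)
  have hcard : detectedUpTo L γ lam p s =
      ((Finset.Icc 2 (periods L)).filter (fun t => t ≤ s ∧ β (t - 1) p ≠ β t p)).card := by
    rw [← hunion, Finset.filter_union,
      Finset.card_union_of_disjoint (Finset.disjoint_filter_filter hdisj), ← hE, ← hO]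
    unfold detectedUpTo
    congr!
  rw [hcard]
  symm
  refine Finset.card_bij (fun j _ => τ p j + 1) ?_ ?_ ?_
  · intro j hj
    rw [Finset.mem_filter, Finset.mem_Icc] at hj
    have h0 := h.strictMonoOn p (a := 0) (b := j) (by simp) (by simp; omega) (by omega)
    have h1 := h.strictMonoOn p (a := j) (b := S p + 1) (by simp; omega) (by simp) (by omega)
    rw [h.last] at h1
    have hm : τ p j + 1 ∈ Finset.Icc 2 (periods L) := by rw [Finset.mem_Icc]; omega
    rw [Finset.mem_filter]
    exact ⟨hm, hj.2, (h.slope_ne_iff hne hm).mpr ⟨j, by simpa using hj.1, rfl⟩⟩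
  · intro i hi j hj hij
    rw [Finset.mem_filter, Finset.mem_Icc] at hi hj
    exact (h.strictMonoOn p).injOn (by simp; omega) (by simp; omega) (by omega)
  · intro t ht
    rw [Finset.mem_filter] at ht
    obtain ⟨j, hj, rfl⟩ := (h.slope_ne_iff hne ht.1).mp ht.2.2
    exact ⟨j, Finset.mem_filter.mpr ⟨hj, ht.2.1⟩, rfl⟩

lemma jumpCount_eq_of_detectedUpTo (h : PiecewiseConstant L S τ β) {γ : ℕ → UIdx P → ℝ} {lam : ℝ}
    {p : Fin P} (hd : ∀ s, detectedUpTo L γ lam p s =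
      ((Finset.Icc 1 (S p)).filter (fun j => τ p j + 1 ≤ s)).card) :
    jumpCount L γ lam p = S p := by
  rw [jumpCount_eq_detectedUpTo, hd, Finset.filter_true_of_mem, Nat.card_Icc, Nat.add_sub_cancel]
  intro j hj
  rw [Finset.mem_Icc] at hj
  rw [← h.last p]
  exact h.strictMonoOn p (by simp; omega) (by simp) (by omega)

lemma jumpLoc_eq_of_detectedUpTo (h : PiecewiseConstant L S τ β) {γ : ℕ → UIdx P → ℝ} {lam : ℝ}
    {p : Fin P} (hd : ∀ s, detectedUpTo L γ lam p s =
      ((Finset.Icc 1 (S p)).filter (fun j => τ p j + 1 ≤ s)).card) {j : ℕ}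
    (hj : j ∈ Finset.Icc 1 (S p)) :
    jumpLoc L γ lam p j = τ p j := by
  rw [Finset.mem_Icc] at hj
  have hle : ∀ i ∈ Finset.Icc 1 (S p), ∀ i' ∈ Finset.Icc 1 (S p), (τ p i ≤ τ p i' ↔ i ≤ i') := by
    intro i hi i' hi'
    rw [Finset.mem_Icc] at hi hi'
    exact (h.strictMonoOn p).le_iff_le (by simp; omega) (by simp; omega)
  rw [jumpLoc]
  refine IsLeast.csInf_eq ⟨?_, ?_⟩
  · change j = _
    have : (Finset.Icc 1 (S p)).filter (fun i => τ p i + 1 ≤ τ p j + 1) = Finset.Icc 1 j := by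
      ext i
      rw [Finset.mem_filter]
      constructor
      · rintro ⟨hi, hij⟩
        have := (hle i hi j (by simpa using hj)).mp (by omega)
        simp at hi ⊢; omega
      · intro hi
        rw [Finset.mem_Icc] at hi
        have hi' : i ∈ Finset.Icc 1 (S p) := by simp; omega
        have := (hle i hi' j (by simpa using hj)).mpr hi.2
        exact ⟨hi', by omega⟩
    rw [hd, this, Nat.card_Icc, Nat.add_sub_cancel]
  · intro s hs
    change j = _ at hs
    by_contra hlt
    have hsub : (Finset.Icc 1 (S p)).filter (fun i => τ p i + 1 ≤ s + 1) ⊆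
        Finset.Icc 1 (j - 1) := by
      intro i hi
      rw [Finset.mem_filter] at hi
      have : ¬ j ≤ i := fun hji => by
        have := (hle j (by simpa using hj) i hi.1).mpr hji
        omega
      have := hi.1
      simp at this ⊢; omega
    have := Finset.card_le_card hsub
    rw [← hd, ← hs, Nat.card_Icc] at this
    omega

end sample

end SAW

/-! ### Tail bounds and limits of probabilities -/

namespace SAW

section measure

variable {Ω : Type*} [MeasurableSpace Ω] {μ : Measure Ω} [IsProbabilityMeasure μ]

/-- The sets need not be measurable: only subadditivity of the outer measure is used. -/
lemma tendsto_measure_one_of_compl {s : ℕ → Set Ω}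
    (h : Tendsto (fun r => μ (s r)ᶜ) atTop (𝓝 0)) : Tendsto (fun r => μ (s r)) atTop (𝓝 1) := by
  have h1 : Tendsto (fun r => 1 - μ (s r)ᶜ) atTop (𝓝 1) := by
    simpa using ENNReal.Tendsto.sub (tendsto_const_nhds (x := (1 : ENNReal))) h (by simp)
  refine tendsto_of_tendsto_of_tendsto_of_le_of_le h1 tendsto_const_nhds (fun r => ?_)
    (fun r => prob_le_one)
  rw [tsub_le_iff_right, ← measure_univ (μ := μ), ← Set.union_compl_self (s r)]
  exact measure_union_le _ _

lemma tendsto_cond_one_of_compl {s t : ℕ → Set Ω}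
    (hs : Tendsto (fun r => μ (s r)ᶜ) atTop (𝓝 0))
    (ht : Tendsto (fun r => μ (t r)ᶜ) atTop (𝓝 0)) :
    Tendsto (fun r => (μ[|s r]) (t r)) atTop (𝓝 1) := by
  have hs1 := tendsto_measure_one_of_compl hs
  have hpos : ∀ᶠ r in atTop, μ (s r) ≠ 0 := hs1.eventually_ne one_ne_zero
  have h0 : Tendsto (fun r => (μ (s r))⁻¹ * μ (t r)ᶜ) atTop (𝓝 0) := by
    simpa using ENNReal.Tendsto.mul (tendsto_inv_iff.mpr hs1) (by simp) ht (by simp)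
  have h1 : Tendsto (fun r => 1 - (μ (s r))⁻¹ * μ (t r)ᶜ) atTop (𝓝 1) := by
    simpa using ENNReal.Tendsto.sub (tendsto_const_nhds (x := (1 : ENNReal))) h0 (by simp)
  refine tendsto_of_tendsto_of_tendsto_of_le_of_le' h1 tendsto_const_nhds ?_ ?_
  · filter_upwards [hpos] with r hr
    have := cond_isProbabilityMeasure (μ := μ) hr
    have h2 : (μ[|s r]) (t r)ᶜ ≤ (μ (s r))⁻¹ * μ (t r)ᶜ := by
      rw [ProbabilityTheory.cond, Measure.smul_apply, smul_eq_mul]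
      gcongr
      exact Measure.restrict_le_self
    rw [tsub_le_iff_right, ← measure_univ (μ := μ[|s r]), ← Set.union_compl_self (t r)]
    exact (measure_union_le _ _).trans (by gcongr)
  · filter_upwards [hpos] with r hr
    have := cond_isProbabilityMeasure (μ := μ) hr
    exact prob_le_one

end measure

/-- The union bound over `N ≥ 2` periods is affordable: if `h → ∞`, deviations of the size
`h log(N)^(1/δ₂)` have tails `N^(-δ₁ h^δ₂)`, which beat the factor `N`. -/
lemma tendsto_card_mul_exp_tail {N h : ℕ → ℝ} {δ₁ δ₂ : ℝ} (hδ₁ : 0 < δ₁) (hδ₂ : 0 < δ₂)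
    (hN : ∀ r, 2 ≤ N r) (hh : Tendsto h atTop atTop) :
    Tendsto (fun r => N r * Real.exp (-δ₁ * (h r * Real.log (N r) ^ (1 / δ₂)) ^ δ₂))
      atTop (𝓝 0) := by
  have hy : Tendsto (fun r => δ₁ * h r ^ δ₂ - 1) atTop atTop :=
    tendsto_atTop_add_const_right _ _
      (((tendsto_rpow_atTop hδ₂).comp hh).const_mul_atTop hδ₁)
  have hlog2 : 0 < Real.log 2 := Real.log_pos one_lt_two
  have hlim : Tendsto (fun r => Real.exp (-((δ₁ * h r ^ δ₂ - 1) * Real.log 2))) atTop (𝓝 0) :=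
    Real.tendsto_exp_neg_atTop_nhds_zero.comp (hy.atTop_mul_const hlog2)
  refine tendsto_of_tendsto_of_tendsto_of_le_of_le' tendsto_const_nhds hlim ?_ ?_
  · filter_upwards with r
    have := hN r
    positivity
  · filter_upwards [hy.eventually_ge_atTop 0, hh.eventually_ge_atTop 0] with r hyr hhr
    have hN0 : 0 < N r := by linarith [hN r]
    have hlog : Real.log 2 ≤ Real.log (N r) := Real.log_le_log two_pos (hN r)
    have hl0 : 0 ≤ Real.log (N r) := hlog2.le.trans hlog
    rw [Real.mul_rpow hhr (by positivity), ← Real.rpow_mul hl0, one_div_mul_cancel hδ₂.ne',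
      Real.rpow_one]
    nth_rewrite 1 [← Real.exp_log hN0]
    rw [← Real.exp_add, Real.exp_le_exp]
    nlinarith [mul_le_mul_of_nonneg_left hlog hyr]

lemma scoreSum_single {Ω : Type*} {P n t : ℕ} (ht : 2 ≤ t) (Z : ℕ → ℕ → Ω → UIdx P → ℝ) (e : ℕ → ℕ → Ω → ℝ)
    (q : UIdx P) (ω : Ω) :
    scoreSum n Z e (t - 1) t q ω =
      ∑ i ∈ Finset.Icc 1 n, Z i t ω q * (e i t ω - e i (t - 1) ω) := by
  rw [scoreSum, Nat.sub_add_cancel (by omega)]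
  simp

section

variable {Ω : Type*} [MeasurableSpace Ω] {P : ℕ}

/-- Tail bound for the score of a single period, with the standard deviation replaced by its
uniform bound. -/
lemma AssumptionC.single_period_tail {μ : Measure Ω} [IsProbabilityMeasure μ] {n L : ℕ → ℕ}
    {Z : ℕ → ℕ → ℕ → Ω → UIdx P → ℝ} {e : ℕ → ℕ → ℕ → Ω → ℝ} {δ₂ : ℝ}
    (hC : AssumptionC μ n L Z e δ₂) (hn : ∀ r, 1 ≤ n r) :
    ∃ M δ₀ δ₁ : ℝ, 0 < M ∧ 0 < δ₀ ∧ 0 < δ₁ ∧ ∀ r, ∀ t ∈ Finset.Icc 2 (periods (L r)), ∀ q,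
      ∀ a : ℝ, 0 < a →
        μ.real {ω | a * √(2 * M * n r) ≤
          |∑ i ∈ Finset.Icc 1 (n r), Z r i t ω q * (e r i t ω - e r i (t - 1) ω)|} ≤
          δ₀ * Real.exp (-δ₁ * a ^ δ₂) := by
  obtain ⟨M, hM⟩ := hC.variance
  obtain ⟨δ₀, δ₁, h0, h1, htail⟩ := hC.tail
  refine ⟨max M 1, δ₀, δ₁, by positivity, h0, h1, fun r t ht q a ha => ?_⟩
  rw [Finset.mem_Icc] at ht
  have hs1 : 1 ≤ t - 1 := by omega
  have hs2 : t - 1 < t := by omega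
  refine le_trans (measureReal_mono fun ω hω => ?_) (htail r (t - 1) t hs1 hs2 ht.2 q a ha)
  rw [Set.mem_ofPred_eq] at hω ⊢
  rw [scoreSum_single ht.1]
  have hcast : (t : ℝ) - ((t - 1 : ℕ) : ℝ) + 1 = 2 := by
    rw [Nat.cast_sub (by omega)]; push_cast; ring
  have hn0 : (0 : ℝ) < n r := by exact_mod_cast hn r
  have hsq : √(2 * max M 1 * n r) = √(max M 1) * √(n r * 2) := by
    rw [← Real.sqrt_mul (by positivity)]; congr 1; ring
  have hpos : 0 < √((n r : ℝ) * 2) := by positivity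
  rw [hcast, inv_mul_eq_div, le_div_iff₀ hpos]
  refine le_trans ?_ hω
  rw [hsq, ← mul_assoc]
  gcongr
  exact ((hM r (t - 1) t hs1 hs2 ht.2 q).2).trans (le_max_left _ _)

/-- The event that the score of some period and coordinate is at least `B`. -/
def largeScore (n L : ℕ) (Z : ℕ → ℕ → Ω → UIdx P → ℝ) (e : ℕ → ℕ → Ω → ℝ) (B : ℝ) : Set Ω :=
  {ω | ∃ t ∈ Finset.Icc 2 (periods L), ∃ q,
    B ≤ |∑ i ∈ Finset.Icc 1 n, Z i t ω q * (e i t ω - e i (t - 1) ω)|}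

lemma measureReal_largeScore_le {μ : Measure Ω} [IsProbabilityMeasure μ] {n L : ℕ}
    {Z : ℕ → ℕ → Ω → UIdx P → ℝ} {e : ℕ → ℕ → Ω → ℝ} {B x : ℝ}
    (h : ∀ t ∈ Finset.Icc 2 (periods L), ∀ q,
      μ.real {ω | B ≤ |∑ i ∈ Finset.Icc 1 n, Z i t ω q * (e i t ω - e i (t - 1) ω)|} ≤ x) :
    μ.real (largeScore n L Z e B) ≤ ((periods L : ℝ) - 1) * (Fintype.card (UIdx P) * x) := by
  have hU : largeScore n L Z e B = ⋃ t ∈ Finset.Icc 2 (periods L), ⋃ q ∈ Finset.univ,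
      {ω | B ≤ |∑ i ∈ Finset.Icc 1 n, Z i t ω q * (e i t ω - e i (t - 1) ω)|} := by
    ext ω
    simp [largeScore]
  have hcard : ((periods L : ℝ) - 1) = ((Finset.Icc 2 (periods L)).card : ℝ) := by
    rw [periods_sub_one, Nat.card_Icc, periods]
    simp
  rw [hU, hcard, ← nsmul_eq_mul, ← nsmul_eq_mul, ← Finset.card_univ]
  refine (measureReal_biUnion_finset_le _ _).trans (Finset.sum_le_card_nsmul _ _ _ fun t ht => ?_)
  exact (measureReal_biUnion_finset_le _ _).trans
    (Finset.sum_le_card_nsmul _ _ _ fun q _ => h t ht q)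

/-- The coefficients `(β_t, β_{t-1}, Δθ_t)` of the differenced model. -/
def trueGamma (β : ℕ → Fin P → ℝ) (θ : ℕ → ℝ) (t : ℕ) : UIdx P → ℝ :=
  Sum.elim (β t) (Sum.elim (β (t - 1)) fun _ => θ t - θ (t - 1))

lemma PanelModel.diff_eq {n L : ℕ} {β : ℕ → Fin P → ℝ} {μ₀ : ℝ} {α θ : ℕ → Ω → ℝ}
    {X : ℕ → ℕ → Ω → Fin P → ℝ} {Z : ℕ → ℕ → Ω → UIdx P → ℝ} {e Y : ℕ → ℕ → Ω → ℝ}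
    (h : PanelModel n L β μ₀ α θ X Z e Y) {i t : ℕ} (hi : i ∈ Finset.Icc 1 n)
    (ht : t ∈ Finset.Icc 2 (periods L)) (ω : Ω) :
    Y i t ω - Y i (t - 1) ω =
      regU (fun i t => X i t ω) i t ⬝ᵥ trueGamma β (fun t => θ t ω) t +
        (e i t ω - e i (t - 1) ω) := by
  rw [Finset.mem_Icc] at ht
  rw [h.model i hi t (by simp; omega), h.model i hi (t - 1) (by simp; omega)]
  simp only [regU, trueGamma, dotProduct, Fintype.sum_sum_type, Sum.elim_inl, Sum.elim_inr,
    neg_mul, Finset.sum_neg_distrib, Finset.univ_unique, Finset.sum_singleton, one_mul]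
  ring

/-- With the scores below `K √(n(T-1)) λ √(2Mn)`, where `K = c / (2 √((2P+1)M))`, the noise in the
univariate coefficients of the finest level stays below the threshold `λ`. -/
lemma topScale_mul_error {n L : ℕ} (hn : 1 ≤ n) {c M lam : ℝ} (hc : 0 < c) (hM : 0 < M) :
    topScale L * (2 * (√(Fintype.card (UIdx P)) *
      (c / (2 * √(Fintype.card (UIdx P)) * √M) * (√(n * ((periods L : ℝ) - 1)) * lam) *
        √(2 * M * n)) / (c * n))) = lam := by
  have hn0 : (0 : ℝ) < n := by exact_mod_cast hn
  have hN : 0 < (periods L : ℝ) - 1 := by rw [periods_sub_one]; positivity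
  have hC : (0 : ℝ) < Fintype.card (UIdx P) := by exact_mod_cast Fintype.card_pos
  have e : c * n = c * (√(n : ℝ) * √(n : ℝ)) := by rw [Real.mul_self_sqrt hn0.le]
  rw [e, topScale, Real.sqrt_mul hn0.le, Real.sqrt_mul zero_le_two,
    Real.sqrt_mul (by positivity : 0 ≤ 2 * M), Real.sqrt_mul zero_le_two]
  have h1 := Real.sqrt_pos.mpr hn0
  have h2 := Real.sqrt_pos.mpr hN
  have h3 := Real.sqrt_pos.mpr hC
  have h4 := Real.sqrt_pos.mpr hM
  have h5 : 0 < √(2 : ℝ) := by positivity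
  generalize √(n : ℝ) = x1 at *
  generalize √((periods L : ℝ) - 1) = x2 at *
  generalize √(Fintype.card (UIdx P) : ℝ) = x3 at *
  generalize √M = x4 at *
  generalize √(2 : ℝ) = x5 at *
  field_simp

lemma two_mul_lt_topScale_mul {L : ℕ} {lam d E c : ℝ} (hlam : 0 ≤ lam) (hE : 0 ≤ E)
    (hsmall : E * (√((periods L : ℝ) - 1) * lam) < c / 4) (hd : c < E * |d|) :
    2 * lam < topScale L * |d| := by
  have hN : 0 < (periods L : ℝ) - 1 := by rw [periods_sub_one]; positivity
  have h1 : E * (4 * (√((periods L : ℝ) - 1) * lam)) < E * |d| := by linarith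
  have h2 := lt_of_mul_lt_mul_left h1 hE
  have h3 : √(2 : ℝ) ≤ 2 := by
    rw [Real.sqrt_le_left two_pos.le]; norm_num
  have h4 : 0 ≤ √((periods L : ℝ) - 1) * lam := by positivity
  rw [topScale, inv_mul_eq_div, lt_div_iff₀ (by positivity), Real.sqrt_mul zero_le_two]
  nlinarith [mul_le_mul_of_nonneg_right h3 h4]

end

end SAW

/-! ### Consistency -/

theorem theorem2 {Ω : Type*} [MeasurableSpace Ω] (μ : Measure Ω) [IsProbabilityMeasure μ]
    (P : ℕ) (n L : ℕ → ℕ)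
    (S : ℕ → Fin P → ℕ) (τ : ℕ → Fin P → ℕ → ℕ) (β : ℕ → ℕ → Fin P → ℝ)
    (μ₀ : ℕ → ℝ) (α θ : ℕ → ℕ → Ω → ℝ)
    (X : ℕ → ℕ → ℕ → Ω → Fin P → ℝ) (Z : ℕ → ℕ → ℕ → Ω → SAW.UIdx P → ℝ)
    (e Y : ℕ → ℕ → ℕ → Ω → ℝ)
    (A : ℕ → Ω → ℕ → ℕ → Matrix (SAW.UIdx P) (SAW.UIdx P) ℝ)
    (b : ℕ → Ω → ℕ → ℕ → SAW.UIdx P → ℝ)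
    (lam : ℕ → ℝ) (δ₂ κ : ℝ)
    (hA : SAW.AssumptionA n L)
    (hβ : ∀ r, SAW.PiecewiseConstant (L r) (S r) (τ r) (β r))
    (hY : ∀ r, SAW.PanelModel (n r) (L r) (β r) (μ₀ r) (α r) (θ r) (X r) (Z r) (e r) (Y r))
    (hB : SAW.AssumptionB μ n L X Z e)
    (hC : SAW.AssumptionC μ n L Z e δ₂)
    (hκ : 0 ≤ κ) (hD : SAW.AssumptionD n L S τ β δ₂ κ)
    (hbasis : ∀ᶠ r in atTop, ∀ᵐ ω ∂μ,
      SAW.IsSAWBasis (n r) (L r) (fun i t => X r i t ω) (fun i t => Z r i t ω) (A r ω))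
    (hIV : ∀ᶠ r in atTop, ∀ᵐ ω ∂μ,
      SAW.IsIVEstimator (n r) (L r) (fun i t => X r i t ω) (fun i t => Z r i t ω) (A r ω)
        (fun i t => Y r i t ω - Y r i (t - 1) ω) (b r ω))
    (hlam_large : Tendsto (fun r =>
      √((n r : ℝ) * ((SAW.periods (L r) : ℝ) - 1)) /
        Real.log ((SAW.periods (L r) : ℝ) - 1) ^ (1 / δ₂) * lam r) atTop atTop)
    (hlam_small : Tendsto (fun r => √((SAW.periods (L r) : ℝ) - 1) * lam r) atTop (𝓝 0))
    (hlam_jump : Tendsto (fun r =>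
      SAW.effSize (n r) (L r) δ₂ ^ (κ / 2) * (√((SAW.periods (L r) : ℝ) - 1) * lam r))
      atTop (𝓝 0)) :
    Tendsto (fun r => μ {ω | ∀ p,
        SAW.jumpCount (L r) (SAW.gammaTilde (L r) (A r ω) (b r ω)) (lam r) p = S r p})
      atTop (𝓝 1) ∧
    Tendsto (fun r =>
      (μ[|{ω | ∀ p,
          SAW.jumpCount (L r) (SAW.gammaTilde (L r) (A r ω) (b r ω)) (lam r) p = S r p}])
        {ω | ∀ p, ∀ j ∈ Finset.Icc 1 (S r p),
          SAW.jumpLoc (L r) (SAW.gammaTilde (L r) (A r ω) (b r ω)) (lam r) p j = τ r p j})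
      atTop (𝓝 1) := by
  obtain ⟨c, hc, hQ⟩ := hB.lower_bound
  obtain ⟨M, δ₀, δ₁, hM, hδ₀, hδ₁, htail⟩ := hC.single_period_tail hA.n_pos
  obtain ⟨d, hd, hjumps⟩ := hD
  have hcard : (0 : ℝ) < Fintype.card (SAW.UIdx P) := by exact_mod_cast Fintype.card_pos
  have hN : ∀ r, (2 : ℝ) ≤ (SAW.periods (L r) : ℝ) - 1 := fun r => by
    rw [SAW.periods_sub_one]
    have := hA.two_le_L r
    exact le_self_pow₀ one_le_two (by omega)
  have hlog : ∀ r, 0 < Real.log ((SAW.periods (L r) : ℝ) - 1) := fun r =>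
    Real.log_pos (by linarith [hN r])
  have hn : ∀ r, (0 : ℝ) < n r := fun r => by exact_mod_cast hA.n_pos r
  -- The factor `K` makes the noise bound of `topScale_mul_error` equal to the threshold.
  set K : ℝ := c / (2 * √(Fintype.card (SAW.UIdx P)) * √M) with hK
  have hK0 : 0 < K := by positivity
  set a : ℕ → ℝ := fun r =>
    K * (√((n r : ℝ) * ((SAW.periods (L r) : ℝ) - 1)) * lam r) with ha
  have ha' : ∀ r, a r = K * (√((n r : ℝ) * ((SAW.periods (L r) : ℝ) - 1)) /
      Real.log ((SAW.periods (L r) : ℝ) - 1) ^ (1 / δ₂) * lam r) *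
        Real.log ((SAW.periods (L r) : ℝ) - 1) ^ (1 / δ₂) := fun r => by
    have := (Real.rpow_pos_of_pos (hlog r) (1 / δ₂)).ne'
    rw [ha]
    field_simp
  have hKlarge := hlam_large.const_mul_atTop hK0
  have hlam0 : ∀ᶠ r in atTop, 0 < lam r := by
    filter_upwards [hlam_large.eventually_gt_atTop 0] with r hr
    have : 0 ≤ √((n r : ℝ) * ((SAW.periods (L r) : ℝ) - 1)) /
        Real.log ((SAW.periods (L r) : ℝ) - 1) ^ (1 / δ₂) := by
      have := hlog r
      positivity
    exact pos_of_mul_pos_right hr this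
  have ha0 : ∀ᶠ r in atTop, 0 < a r := by
    filter_upwards [hlam0] with r hr
    have := hN r
    have := hn r
    have : 0 < (SAW.periods (L r) : ℝ) - 1 := by linarith
    rw [ha]
    positivity
  set bad : ℕ → Set Ω := fun r =>
    SAW.largeScore (n r) (L r) (Z r) (e r) (a r * √(2 * M * n r)) with hbad
  have hbad0 : Tendsto (fun r => μ (bad r)) atTop (𝓝 0) := by
    have hlim := (SAW.tendsto_card_mul_exp_tail hδ₁ hC.delta_pos hN hKlarge).const_mul
      (Fintype.card (SAW.UIdx P) * δ₀)
    rw [mul_zero] at hlim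
    have hreal : Tendsto (fun r => μ.real (bad r)) atTop (𝓝 0) := by
      refine tendsto_of_tendsto_of_tendsto_of_le_of_le' tendsto_const_nhds hlim
        (Eventually.of_forall fun r => measureReal_nonneg) ?_
      filter_upwards [ha0] with r har
      refine (SAW.measureReal_largeScore_le fun t ht q => htail r t ht q (a r) har).trans
        (le_of_eq ?_)
      rw [← ha' r]
      ring
    have := ENNReal.tendsto_ofReal hreal
    simpa using this
  have hgood : ∀ᶠ r in atTop, ∀ᵐ ω ∂μ, ω ∉ bad r → ∀ p,
      SAW.jumpCount (L r) (SAW.gammaTilde (L r) (A r ω) (b r ω)) (lam r) p = S r p ∧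
      ∀ j ∈ Finset.Icc 1 (S r p),
        SAW.jumpLoc (L r) (SAW.gammaTilde (L r) (A r ω) (b r ω)) (lam r) p j = τ r p j := by
    have hdsmall := hlam_jump.eventually_lt_const (show 0 < d / 4 by positivity)
    filter_upwards [hQ, hjumps, hbasis, hIV, hlam0, ha0, hdsmall]
      with r hQr hjr hbr hIVr hlr har hdr
    filter_upwards [hQr, hbr, hIVr] with ω hQω hbω hIVω hω p
    have hL := hA.two_le_L r
    have hscore : ∀ t ∈ Finset.Icc 2 (SAW.periods (L r)), ∀ q,
        |∑ i ∈ Finset.Icc 1 (n r), Z r i t ω q * (e r i t ω - e r i (t - 1) ω)| ≤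
          a r * √(2 * M * n r) := by
      intro t ht q
      by_contra hlt
      exact hω ⟨t, ht, q, (not_le.mp hlt).le⟩
    have herr : ∀ t ∈ Finset.Icc 2 (SAW.periods (L r)), ∀ q,
        |SAW.gammaTilde (L r) (A r ω) (b r ω) t q -
            SAW.trueGamma (β r) (fun t => θ r t ω) t q| ≤
          √(Fintype.card (SAW.UIdx P)) * (a r * √(2 * M * n r)) / (c * n r) :=
      fun t ht q => hIVω.error_bound hbω (hA.n_pos r) (by omega)
        (ε := fun i t => e r i t ω - e r i (t - 1) ω)
        (fun i hi t ht => (hY r).diff_eq hi ht ω) hc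
        (hQω (L r) (by simp; omega)) (by positivity) ht (hscore t ht) q
    have heff : 0 ≤ SAW.effSize (n r) (L r) δ₂ ^ (κ / 2) := by
      have := hlog r
      refine Real.rpow_nonneg ?_ _
      rw [SAW.effSize]
      positivity
    have hdet := SAW.detectedUpTo_eq hL (hβ r) hlr.le (p := p)
      (γ' := SAW.trueGamma (β r) (fun t => θ r t ω)) (fun _ _ => rfl) (fun _ _ => rfl) herr
      (SAW.topScale_mul_error (hA.n_pos r) hc hM).le
      (fun j hj => SAW.two_mul_lt_topScale_mul hlr.le heff hdr (hjr p j hj))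
    exact ⟨SAW.jumpCount_eq_of_detectedUpTo (hβ r) hdet,
      fun j hj => SAW.jumpLoc_eq_of_detectedUpTo (hβ r) hdet hj⟩
  have hcompl : ∀ s : ℕ → Set Ω,
      (∀ᶠ r in atTop, ∀ᵐ ω ∂μ, ω ∉ bad r → ω ∈ s r) →
        Tendsto (fun r => μ (s r)ᶜ) atTop (𝓝 0) := by
    intro s hs
    refine tendsto_of_tendsto_of_tendsto_of_le_of_le' tendsto_const_nhds hbad0
      (Eventually.of_forall fun r => zero_le) ?_
    filter_upwards [hs] with r hr
    refine measure_mono_ae ?_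
    filter_upwards [hr] with ω hω hωs
    by_contra h
    exact hωs (hω h)
  have hcount := hcompl (fun r => {ω | ∀ p,
      SAW.jumpCount (L r) (SAW.gammaTilde (L r) (A r ω) (b r ω)) (lam r) p = S r p}) (by
    filter_upwards [hgood] with r hr
    filter_upwards [hr] with ω hω h p using (hω h p).1)
  have hloc := hcompl (fun r => {ω | ∀ p, ∀ j ∈ Finset.Icc 1 (S r p),
      SAW.jumpLoc (L r) (SAW.gammaTilde (L r) (A r ω) (b r ω)) (lam r) p j = τ r p j}) (by
    filter_upwards [hgood] with r hr
    filter_upwards [hr] with ω hω h p using (hω h p).2)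
  exact ⟨SAW.tendsto_measure_one_of_compl hcount, SAW.tendsto_cond_one_of_compl hcount hloc⟩
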